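/- Let $G$ be a finite group and let $D(G)$ be its Drinfel'd double over $\mathbb{C}$: the Hopf algebra with basis $e_g\# h$ ($g,h\in G$), product $(e_a\# h)(e_b\# k)=\delta_{a,\,hbh^{-1}}\,e_a\# hk$, unit $\sum_g e_g\#1$, coproduct $\Delta(e_g\# h)=\sum_{ab=g}(e_a\# h)\otimes(e_b\# h)$, counit $\varepsilon(e_g\# h)=\delta_{g,1}$ and antipode $S(e_g\# h)=e_{h^{-1}g^{-1}h}\# h^{-1}$. Let $\Lambda$ be the normalized integral of $D(G)$ (that is, $x\Lambda=\varepsilon(x)\Lambda$ for all $x$, and $\varepsilon(\Lambda)=1$), and for $x\in D(G)$ and $n\ge 1$ let $x^{[n]}=x_1x_2\cdots x_n$ be the Sweedler power. The $n$-th Frobenius–Schur indicator of a finite-dimensional representation of $D(G)$ with character $\chi$ is $\nu_n(\chi)=\chi(\Lambda^{[n]})$. For a finite group $K$, let $I(K)$ be the set of its irreducible complex characters, $R(K)$ the group of virtual characters ($\mathbb{Z}$-linear combinations of elements of $I(K)$), and $\langle\varphi,\psi\rangle_K=|K|^{-1}\sum_{x\in K}\varphi(x)\overline{\psi(x)}$.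 Two elements $g,h\in K$ lie in the same rational conjugacy class of $K$ if $h$ is conjugate in $K$ to $g^m$ for some $m$ with $\gcd(m,|K|)=1$. Fix $u\in G$ with centralizer $C=C_G(u)$. For $\eta\in I(C)$ afforded by the irreducible representation $W$ of $C$, let $\chi_\eta$ be the character of the $D(G)$-module $\mathbb{C}G\otimes_{\mathbb{C}C}W$, on which $e_g\# h$ acts by $(e_g\# h)(x\otimes w)=\delta_{g,\,hxu(hx)^{-1}}\,hx\otimes w$ for $x \in G$, $w \in W$. Let $n$ be a positive integer, and for $g\in G$ put $G_n(u,g)=\{a\in G : (au^{-1})^n=a^n=g\}$; define $\zeta_n:C\to\mathbb{Z}$ by $\zeta_n(g)=|G_n(u,g)|$. Then the following are equivalent: 1. $\nu_n(\chi_\eta)\in\mathbb{Z}$ for each $\eta\in I(C)$; 2. $\zeta_n\in R(C)$; 3. $\langle \mathrm{Res}^C_H\,\zeta_n,\lambda\rangle_H\in\mathbb{Q}$ for each cyclic subgroup $H\subseteq C$ and each $\lambda\in I(H)$; 4. $\zeta_n$ is constant on the rational conjugacy classes of $C$. -/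

import Mathlib

open scoped TensorProduct

noncomputable section

/-! ### Integrals, Sweedler powers and indicators for Hopf algebras -/

/-- `Λ` is a normalized (left) integral: `h Λ = ε(h) Λ` for all `h`, and `ε(Λ) = 1`. -/
def IsNormalizedIntegral {H : Type*} [Ring H] [HopfAlgebra ℂ H] (Λ : H) : Prop :=
  (∀ h : H, h * Λ = (Coalgebra.counit (R := ℂ) h) • Λ) ∧ Coalgebra.counit (R := ℂ) Λ = 1

/-- The Sweedler power `h^{[n]} = h₁ h₂ ⋯ hₙ`: the `n`-th convolution power of the identity map of
`H`, evaluated at `h`. -/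
def sweedlerPower {H : Type*} [Ring H] [HopfAlgebra ℂ H] (n : ℕ) (h : H) : H :=
  ((WithConv.toConv (LinearMap.id : H →ₗ[ℂ] H)) ^ n).ofConv h

/-- The `n`-th Frobenius–Schur indicator `χ(Λ^{[n]})` of a representation `ρ` of a Hopf algebra,
where `χ` is the character (trace function) of `ρ` and `Λ` is the normalized integral. -/
def hopfIndicator {H : Type*} [Ring H] [HopfAlgebra ℂ H] (Λ : H) (n : ℕ)
    {V : Type*} [AddCommGroup V] [Module ℂ V] (ρ : H →ₐ[ℂ] Module.End ℂ V) : ℂ :=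
  LinearMap.trace ℂ V (ρ (sweedlerPower n Λ))

/-! ### The Drinfel'd double of a finite group -/

/-- The Drinfel'd double `D(G) = ℂ^G ⋊ ℂG`. The element `f` stands for
`∑ f (g, h) • (e_g # h)`, with `e_g` the indicator function of `g`. -/
def DrinfeldDouble (G : Type*) : Type _ := G × G → ℂ

namespace DrinfeldDouble

variable {G : Type*}

instance instAddCommGroup : AddCommGroup (DrinfeldDouble G) := inferInstanceAs (AddCommGroup (G × G → ℂ))

instance : Module ℂ (DrinfeldDouble G) := inferInstanceAs (Module ℂ (G × G → ℂ))

theorem add_apply (x y : DrinfeldDouble G) (p : G × G) : (x + y) p = x p + y p := rfl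

theorem smul_apply (c : ℂ) (x : DrinfeldDouble G) (p : G × G) : (c • x) p = c * x p := rfl

theorem zero_apply (p : G × G) : (0 : DrinfeldDouble G) p = 0 := rfl

/-- The coordinate functional at `p`. -/
def coord (p : G × G) : DrinfeldDouble G →ₗ[ℂ] ℂ where
  toFun x := x p
  map_add' _ _ := rfl
  map_smul' _ _ := rfl

theorem coord_apply (p : G × G) (x : DrinfeldDouble G) : coord p x = x p := rfl

theorem coord_ext {x y : DrinfeldDouble G} (H : ∀ p, coord p x = coord p y) : x = y :=
  funext H

/-- The basis element `e_g # h`. -/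
def e [DecidableEq G] (g h : G) : DrinfeldDouble G :=
  (Pi.single (g, h) (1 : ℂ) : G × G → ℂ)

theorem e_apply [DecidableEq G] (g h : G) (p : G × G) :
    e g h p = if p.1 = g ∧ p.2 = h then 1 else 0 := by
  rw [e, Pi.single_apply]
  simp only [Prod.ext_iff]

variable [Fintype G] [DecidableEq G]

theorem eq_sum (x : DrinfeldDouble G) : x = ∑ g, ∑ h, x (g, h) • e g h := by
  refine coord_ext fun p => ?_
  obtain ⟨a, b⟩ := p
  simp only [map_sum, map_smul, coord_apply, e_apply, smul_eq_mul]
  rw [Finset.sum_eq_single a, Finset.sum_eq_single b]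
  · simp
  · intro c _ hc; simp [hc.symm]
  · simp
  · intro c _ hc; simp [hc.symm]
  · simp

theorem induction {P : DrinfeldDouble G → Prop} (x : DrinfeldDouble G)
    (h0 : P 0) (hadd : ∀ x y, P x → P y → P (x + y)) (hsmul : ∀ (c : ℂ) x, P x → P (c • x))
    (he : ∀ g h, P (e g h)) : P x := by
  rw [eq_sum x]
  exact Finset.sum_induction _ P hadd h0 fun g _ =>
    Finset.sum_induction _ P hadd h0 fun h _ => hsmul _ _ (he g h)

theorem hom_ext {M : Type*} [AddCommGroup M] [Module ℂ M] {f f' : DrinfeldDouble G →ₗ[ℂ] M}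
    (H : ∀ g h, f (e g h) = f' (e g h)) : f = f' := by
  ext x
  rw [eq_sum x]
  simp [H]

/-- The linear map out of `D(G)` with prescribed values on the basis `e_g # h`. -/
def lin {M : Type*} [AddCommGroup M] [Module ℂ M] (F : G → G → M) : DrinfeldDouble G →ₗ[ℂ] M :=
  ∑ g, ∑ h, (coord (g, h)).smulRight (F g h)

theorem lin_e {M : Type*} [AddCommGroup M] [Module ℂ M] (F : G → G → M) (g h : G) :
    lin F (e g h) = F g h := by
  simp only [lin, LinearMap.sum_apply, LinearMap.smulRight_apply, coord_apply, e_apply]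
  rw [Finset.sum_eq_single g, Finset.sum_eq_single h]
  · simp
  · intro c _ hc; simp [hc]
  · simp
  · intro c _ hc; simp [hc]
  · simp

variable [Group G]

/-- The multiplication as a bilinear map:
`(e_a # h) (e_b # k) = δ_{a, h b h⁻¹} e_a # (h k)`. -/
def mulLin : DrinfeldDouble G →ₗ[ℂ] DrinfeldDouble G →ₗ[ℂ] DrinfeldDouble G :=
  lin fun a h => lin fun b k => if a = h * b * h⁻¹ then e a (h * k) else 0

instance : Mul (DrinfeldDouble G) := ⟨fun x y => mulLin x y⟩

instance : One (DrinfeldDouble G) := ⟨∑ g, e g 1⟩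

theorem mul_def (x y : DrinfeldDouble G) : x * y = mulLin x y := rfl

theorem one_def : (1 : DrinfeldDouble G) = ∑ g, e g 1 := rfl

theorem e_mul_e (a h b k : G) :
    (e a h * e b k : DrinfeldDouble G) = if a = h * b * h⁻¹ then e a (h * k) else 0 := by
  rw [mul_def, mulLin, lin_e, lin_e]

theorem mulLin_e (a h b k : G) :
    mulLin (e a h) (e b k) = if a = h * b * h⁻¹ then e a (h * k) else 0 := e_mul_e a h b k

theorem mulLin_assoc (x y z : DrinfeldDouble G) :
    mulLin (mulLin x y) z = mulLin x (mulLin y z) := by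
  induction x using induction with
  | h0 => simp
  | hadd x x' hx hx' => simp [hx, hx']
  | hsmul c x hx => simp [hx]
  | he a h =>
  induction y using induction with
  | h0 => simp
  | hadd x x' hx hx' => simp [hx, hx']
  | hsmul c x hx => simp [hx]
  | he b k =>
  induction z using induction with
  | h0 => simp
  | hadd x x' hx hx' => simp [hx, hx']
  | hsmul c x hx => simp [hx]
  | he c l =>
  have hk : h * (k * c * k⁻¹) * h⁻¹ = h * k * c * (h * k)⁻¹ := by group
  by_cases h2 : b = k * c * k⁻¹
  · subst h2
    by_cases h1 : a = h * (k * c * k⁻¹) * h⁻¹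
    · rw [mulLin_e, if_pos h1, mulLin_e, if_pos (h1.trans hk), mulLin_e, if_pos rfl, mulLin_e,
        if_pos h1, mul_assoc]
    · rw [mulLin_e, if_neg h1, mulLin_e, if_pos rfl, mulLin_e, if_neg h1, map_zero,
        LinearMap.zero_apply]
  · rw [mulLin_e b, if_neg h2, map_zero, mulLin_e]
    split_ifs with h1
    · rw [mulLin_e, if_neg]
      intro h3
      exact h2 (mul_left_cancel (mul_right_cancel (h1.symm.trans (h3.trans hk.symm))))
    · simp

instance : Ring (DrinfeldDouble G) where
  __ := (instAddCommGroup : AddCommGroup (DrinfeldDouble G))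
  left_distrib x y z := by simp [mul_def]
  right_distrib x y z := by simp [mul_def]
  zero_mul x := by simp [mul_def]
  mul_zero x := by simp [mul_def]
  mul_assoc x y z := mulLin_assoc x y z
  one_mul x := by
    rw [mul_def, one_def]
    induction x using induction with
    | h0 => simp
    | hadd x x' hx hx' => rw [map_add, hx, hx']
    | hsmul c x hx => rw [map_smul, hx]
    | he a h => simp [mulLin_e]
  mul_one x := by
    rw [mul_def, one_def]
    induction x using induction with
    | h0 => simp
    | hadd x x' hx hx' => rw [map_add, LinearMap.add_apply, hx, hx']
    | hsmul c x hx => rw [map_smul, LinearMap.smul_apply, hx]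
    | he a h =>
      rw [map_sum, Finset.sum_eq_single (h⁻¹ * a * h)]
      · simp [mulLin_e, mul_assoc]
      · intro b _ hb
        rw [mulLin_e, if_neg]
        rintro rfl
        apply hb
        group
      · simp

instance : Algebra ℂ (DrinfeldDouble G) :=
  Algebra.ofModule (fun c x y => by simp [mul_def]) (fun c x y => by simp [mul_def])

/-- `ε(e_g # h) = δ_{g,1}`. -/
def counitLin : DrinfeldDouble G →ₗ[ℂ] ℂ := lin fun g _ => if g = 1 then 1 else 0

/-- `Δ(e_g # h) = ∑_{ab = g} (e_a # h) ⊗ (e_b # h)`. -/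
def comulLin : DrinfeldDouble G →ₗ[ℂ] DrinfeldDouble G ⊗[ℂ] DrinfeldDouble G :=
  lin fun g h => ∑ a, e a h ⊗ₜ[ℂ] e (a⁻¹ * g) h

/-- `S(e_g # h) = e_{h⁻¹ g⁻¹ h} # h⁻¹`. -/
def antipodeLin : DrinfeldDouble G →ₗ[ℂ] DrinfeldDouble G :=
  lin fun g h => e (h⁻¹ * g⁻¹ * h) h⁻¹

theorem counitLin_e (g h : G) : counitLin (e g h) = if g = 1 then 1 else 0 := lin_e _ g h

theorem comulLin_e (g h : G) :
    comulLin (e g h) = ∑ a, e a h ⊗ₜ[ℂ] e (a⁻¹ * g) h := lin_e _ g h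

theorem antipodeLin_e (g h : G) : antipodeLin (e g h) = e (h⁻¹ * g⁻¹ * h) h⁻¹ := lin_e _ g h

instance : CoalgebraStruct ℂ (DrinfeldDouble G) where
  comul := comulLin
  counit := counitLin

theorem comul_e (g h : G) :
    Coalgebra.comul (R := ℂ) (e g h) = ∑ a, e a h ⊗ₜ[ℂ] e (a⁻¹ * g) h := comulLin_e g h

theorem counit_e (g h : G) :
    Coalgebra.counit (R := ℂ) (e g h) = if g = 1 then 1 else 0 := counitLin_e g h

instance : Coalgebra ℂ (DrinfeldDouble G) where
  coassoc := by
    refine hom_ext fun g h => ?_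
    simp only [LinearMap.comp_apply, comul_e, map_sum, LinearMap.rTensor_tmul,
      LinearMap.lTensor_tmul, TensorProduct.sum_tmul, TensorProduct.tmul_sum,
      LinearEquiv.coe_coe, TensorProduct.assoc_tmul]
    rw [Finset.sum_comm]
    refine Finset.sum_congr rfl fun a _ => ?_
    refine Fintype.sum_equiv (Equiv.mulLeft a⁻¹) _ _ fun b => ?_
    simp [mul_assoc]
  rTensor_counit_comp_comul := by
    refine hom_ext fun g h => ?_
    simp [LinearMap.comp_apply, comul_e, counit_e, TensorProduct.ite_tmul]
  lTensor_counit_comp_comul := by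
    refine hom_ext fun g h => ?_
    simp [LinearMap.comp_apply, comul_e, counit_e, TensorProduct.tmul_ite, inv_mul_eq_one]

theorem counit_mul' (x y : DrinfeldDouble G) :
    Coalgebra.counit (R := ℂ) (x * y) =
      Coalgebra.counit (R := ℂ) x * Coalgebra.counit (R := ℂ) y := by
  induction x using induction with
  | h0 => simp
  | hadd x x' hx hx' => simp [add_mul, hx, hx']
  | hsmul c x hx => simp [hx, mul_assoc]
  | he a h =>
  induction y using induction with
  | h0 => simp
  | hadd x x' hx hx' => simp [mul_add, hx, hx']
  | hsmul c x hx => simp [hx]; ring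
  | he b k =>
  rw [e_mul_e, counit_e, counit_e]
  by_cases hb : b = 1
  · subst hb
    by_cases ha : a = 1 <;> simp [ha, counit_e]
  · by_cases ha : a = 1
    · subst ha
      have : ¬ (1 : G) = h * b * h⁻¹ := by
        intro h1
        exact hb (conj_eq_one_iff.mp h1.symm)
      simp [this, hb]
    · split_ifs <;> simp [counit_e, ha]

theorem comul_mul' (x y : DrinfeldDouble G) :
    Coalgebra.comul (R := ℂ) (x * y) =
      Coalgebra.comul (R := ℂ) x * Coalgebra.comul (R := ℂ) y := by
  induction x using induction with
  | h0 => simp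
  | hadd x x' hx hx' => simp [add_mul, hx, hx']
  | hsmul c x hx =>
    rw [smul_mul_assoc, map_smul, hx, map_smul]
    exact (Algebra.smul_mul_assoc c _ _).symm
  | he a h =>
  induction y using induction with
  | h0 => simp
  | hadd x x' hx hx' => simp [mul_add, hx, hx']
  | hsmul c x hx =>
    rw [mul_smul_comm, map_smul, hx, map_smul]
    exact (Algebra.mul_smul_comm c _ _).symm
  | he b k =>
  rw [e_mul_e, comul_e, comul_e, Finset.sum_mul_sum]
  have key : ∀ c : G, ∑ d : G, (e c h ⊗ₜ[ℂ] e (c⁻¹ * a) h) * (e d k ⊗ₜ[ℂ] e (d⁻¹ * b) k) =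
      if a = h * b * h⁻¹ then e c (h * k) ⊗ₜ[ℂ] e (c⁻¹ * a) (h * k) else 0 := by
    intro c
    rw [Finset.sum_eq_single (h⁻¹ * c * h)]
    · rw [Algebra.TensorProduct.tmul_mul_tmul, e_mul_e, e_mul_e]
      have h1 : c = h * (h⁻¹ * c * h) * h⁻¹ := by group
      have h2 : (c⁻¹ * a = h * ((h⁻¹ * c * h)⁻¹ * b) * h⁻¹) ↔ a = h * b * h⁻¹ := by
        have : h * ((h⁻¹ * c * h)⁻¹ * b) * h⁻¹ = c⁻¹ * (h * b * h⁻¹) := by group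
        rw [this, mul_right_inj]
      rw [if_pos h1]
      simp only [h2]
      split_ifs <;> simp
    · intro d _ hd
      rw [Algebra.TensorProduct.tmul_mul_tmul, e_mul_e, if_neg, TensorProduct.zero_tmul]
      rintro rfl
      apply hd
      group
    · simp
  simp only [key]
  split_ifs
  · rw [comul_e]
  · simp

instance : Bialgebra ℂ (DrinfeldDouble G) :=
  Bialgebra.mk' ℂ (DrinfeldDouble G)
    (by rw [one_def, map_sum]; simp [counit_e])
    (fun {x y} => counit_mul' x y)
    (by
      rw [one_def, map_sum, Algebra.TensorProduct.one_def, one_def, TensorProduct.sum_tmul]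
      simp only [comul_e, TensorProduct.tmul_sum]
      rw [Finset.sum_comm]
      refine Finset.sum_congr rfl fun a _ => ?_
      exact Fintype.sum_equiv (Equiv.mulLeft a⁻¹) _ _ fun b => by simp)
    (fun {x y} => comul_mul' x y)

instance : HopfAlgebra ℂ (DrinfeldDouble G) where
  antipode := antipodeLin
  mul_antipode_rTensor_comul := by
    refine hom_ext fun g h => ?_
    simp only [LinearMap.comp_apply, comul_e, map_sum, LinearMap.rTensor_tmul, antipodeLin_e,
      LinearMap.mul'_apply, e_mul_e, counit_e, Algebra.linearMap_apply]
    have h1 : ∀ a : G, (h⁻¹ * a⁻¹ * h = h⁻¹ * (a⁻¹ * g) * h⁻¹⁻¹) ↔ g = 1 := by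
      intro a
      rw [inv_inv, mul_left_inj, mul_right_inj]
      simp
    simp only [h1, inv_mul_cancel]
    split_ifs
    · rw [map_one, one_def]
      exact Fintype.sum_equiv ((Equiv.inv G).trans (MulAut.conj h⁻¹).toEquiv) _ _
        fun a => by simp
    · simp
  mul_antipode_lTensor_comul := by
    refine hom_ext fun g h => ?_
    simp only [LinearMap.comp_apply, comul_e, map_sum, LinearMap.lTensor_tmul, antipodeLin_e,
      LinearMap.mul'_apply, e_mul_e, counit_e, Algebra.linearMap_apply]
    have h1 : ∀ a : G, (a = h * (h⁻¹ * (a⁻¹ * g)⁻¹ * h) * h⁻¹) ↔ g = 1 := by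
      intro a
      have : h * (h⁻¹ * (a⁻¹ * g)⁻¹ * h) * h⁻¹ = g⁻¹ * a := by group
      rw [this]
      simp
    simp only [h1, mul_inv_cancel]
    split_ifs
    · rw [map_one, one_def]
    · simp

/-- `D(G)` has a normalized integral, namely `|G|⁻¹ ∑_h e_1 # h`. -/
theorem exists_isNormalizedIntegral : ∃ Λ : DrinfeldDouble G, IsNormalizedIntegral Λ := by
  refine ⟨(Fintype.card G : ℂ)⁻¹ • ∑ h, e 1 h, fun x => ?_, ?_⟩
  · induction x using induction with
    | h0 => simp
    | hadd x x' hx hx' => rw [add_mul, hx, hx', map_add, add_smul]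
    | hsmul c x hx => rw [smul_mul_assoc, hx, map_smul, smul_assoc]
    | he a k =>
      rw [mul_smul_comm, Finset.mul_sum, smul_comm, counit_e]
      congr 1
      simp only [e_mul_e, mul_one, mul_inv_cancel]
      split_ifs with ha
      · subst ha
        rw [one_smul]
        exact Fintype.sum_equiv (Equiv.mulLeft k) _ _ fun b => by simp
      · simp
  · have : (Fintype.card G : ℂ) ≠ 0 := by simp
    simp [counit_e, this]

end DrinfeldDouble

/-! ### The irreducible `D(G)`-modules attached to `(u, η)` -/

section Induced

variable {G : Type*} [Group G] [Fintype G] [DecidableEq G]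

/-- The centralizer `C(u)` of `u` in `G`. -/
abbrev centralizerOf (u : G) : Subgroup G := Subgroup.centralizer {u}

variable (u : G) {W : Type*} [AddCommGroup W] [Module ℂ W]
  (η : Representation ℂ (centralizerOf u) W)

/-- The induced module `ℂG ⊗_{ℂC(u)} W`. In Mathlib's model, the class `⟦x ⊗ w⟧` is the element
written `x⁻¹ ⊗ w` in `ℂG ⊗_{ℂC(u)} W`, and `h ∈ G` acts by `⟦x ⊗ w⟧ ↦ ⟦x h⁻¹ ⊗ w⟧`. -/
abbrev doubleModule : Type _ := Representation.IndV (centralizerOf u).subtype η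

open scoped MonoidAlgebra

/-- On `ℂ[G]`: keep those `x` with `x⁻¹ u x = g`, kill the others. -/
def degreeFilter (g : G) : ℂ[G] →ₗ[ℂ] ℂ[G] :=
  (MonoidAlgebra.basis G ℂ).constr ℂ fun x =>
    if x⁻¹ * u * x = g then MonoidAlgebra.single x 1 else 0

theorem degreeFilter_single (g x : G) :
    degreeFilter u g (MonoidAlgebra.single x 1) =
      if x⁻¹ * u * x = g then MonoidAlgebra.single x 1 else 0 := by
  have := (MonoidAlgebra.basis G ℂ).constr_basis ℂ (fun x =>
    if x⁻¹ * u * x = g then (MonoidAlgebra.single x 1 : ℂ[G]) else 0) x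
  simpa [degreeFilter] using this

/-- The action of `e_g ∈ ℂ^G` on the induced module: `e_g (y ⊗ w) = δ_{g, y u y⁻¹} y ⊗ w`,
where `y ⊗ w` is the class `⟦y⁻¹ ⊗ w⟧`. -/
def degreeProj (g : G) : Module.End ℂ (doubleModule u η) :=
  Representation.Coinvariants.map _ _ ⟨(degreeFilter u g).rTensor W, fun c => by
    ext x w
    have hc : c.1 * u = u * c.1 := Subgroup.mem_centralizer_singleton_iff.mp c.2
    have hx : (c.1 * x)⁻¹ * u * (c.1 * x) = x⁻¹ * u * x := by
      rw [mul_inv_rev, mul_assoc, mul_assoc, ← mul_assoc u, ← hc]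
      group
    have h1 := degreeFilter_single u g (c.1 * x)
    have h2 := degreeFilter_single u g x
    rw [hx] at h1
    by_cases h : x⁻¹ * u * x = g <;> simp [h1, h2, h]⟩

theorem degreeProj_mk (g x : G) (w : W) :
    degreeProj u η g (Representation.IndV.mk _ η x w) =
      if x⁻¹ * u * x = g then Representation.IndV.mk _ η x w else 0 := by
  have h2 := degreeFilter_single u g x
  by_cases h : x⁻¹ * u * x = g <;> simp [degreeProj, h2, h]

/-- The representation of `D(G)` on `ℂG ⊗_{ℂC(u)} W`: the element `e_g # h` acts as the action of
`h` followed by that of `e_g`. -/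
def doubleRep : DrinfeldDouble G →ₐ[ℂ] Module.End ℂ (doubleModule u η) :=
  AlgHom.ofLinearMap
    (DrinfeldDouble.lin fun g h =>
      degreeProj u η g * Representation.ind (centralizerOf u).subtype η h)
    (by
      rw [DrinfeldDouble.one_def, map_sum]
      simp only [DrinfeldDouble.lin_e, map_one, mul_one]
      refine Representation.IndV.hom_ext _ _ fun x => LinearMap.ext fun w => ?_
      simp only [LinearMap.comp_apply, LinearMap.sum_apply, Module.End.one_apply]
      refine Eq.trans (Finset.sum_congr rfl fun g _ => degreeProj_mk u η g x w) ?_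
      rw [Finset.sum_ite_eq]
      simp)
    (fun x y => by
      induction x using DrinfeldDouble.induction with
      | h0 => simp
      | hadd x x' hx hx' => simp only [add_mul, map_add, hx, hx']
      | hsmul c x hx => simp only [smul_mul_assoc, map_smul, hx]
      | he a h =>
      induction y using DrinfeldDouble.induction with
      | h0 => simp
      | hadd x x' hx hx' => simp only [mul_add, map_add, hx, hx']
      | hsmul c x hx => simp only [mul_smul_comm, map_smul, hx]
      | he b k =>
      rw [DrinfeldDouble.e_mul_e, apply_ite (DrinfeldDouble.lin _), map_zero]
      simp only [DrinfeldDouble.lin_e]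
      refine Representation.IndV.hom_ext _ _ fun x => LinearMap.ext fun w => ?_
      have hR : (degreeProj u η a * Representation.ind (centralizerOf u).subtype η h *
          (degreeProj u η b * Representation.ind (centralizerOf u).subtype η k))
            (Representation.IndV.mk _ η x w) =
          if a = h * b * h⁻¹ ∧ (x * (h * k)⁻¹)⁻¹ * u * (x * (h * k)⁻¹) = a then
            Representation.IndV.mk _ η (x * (h * k)⁻¹) w else 0 := by
        simp only [Module.End.mul_apply]
        rw [Representation.ind_mk, degreeProj_mk]
        have h0 : x * k⁻¹ * h⁻¹ = x * (h * k)⁻¹ := by group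
        have h1 : (x * (h * k)⁻¹)⁻¹ * u * (x * (h * k)⁻¹) =
          h * ((x * k⁻¹)⁻¹ * u * (x * k⁻¹)) * h⁻¹ := by group
        rw [h1]
        by_cases hb : (x * k⁻¹)⁻¹ * u * (x * k⁻¹) = b
        · rw [if_pos hb, Representation.ind_mk, degreeProj_mk, h0, h1, hb]
          simp [eq_comm]
        · rw [if_neg hb, map_zero, map_zero, if_neg]
          rintro ⟨h2, h3⟩
          exact hb (mul_left_cancel (mul_right_cancel (h3.trans h2)))
      refine Eq.trans ?_ hR.symm
      by_cases ha : a = h * b * h⁻¹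
      · rw [if_pos ha]
        simp only [ha, true_and]
        change degreeProj u η _ (Representation.ind _ η _ (Representation.IndV.mk _ η x w)) = _
        rw [Representation.ind_mk, degreeProj_mk]
      · simp [ha])

end Induced

/-! ### Characters, class functions and the function `ζ_n` -/

section Characters

/-- `I(G)`: the irreducible complex characters of `G`. (Every finite-dimensional representation is
isomorphic to one on some `ℂ^d`, so it is enough to let the carrier range over `Type`.) -/
def irrChars (G : Type*) [Group G] : Set (G → ℂ) :=
  {χ | ∃ (W : Type) (_ : AddCommGroup W) (_ : Module ℂ W) (_ : FiniteDimensional ℂ W)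
    (ρ : Representation ℂ G W), ρ.IsIrreducible ∧ χ = ρ.character}

/-- `R(G)`: the virtual characters, i.e. the `ℤ`-linear combinations of irreducible characters. -/
def virtualChars (G : Type*) [Group G] : AddSubgroup (G → ℂ) :=
  AddSubgroup.closure (irrChars G)

/-- `⟨φ, ψ⟩_G = |G|⁻¹ ∑_g φ(g) conj(ψ(g))`, for a finite group `G`. -/
def cfInner {G : Type*} [Group G] [Finite G] (φ ψ : G → ℂ) : ℂ :=
  (Nat.card G : ℂ)⁻¹ * ∑ᶠ g : G, φ g * (starRingEnd ℂ) (ψ g)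

/-- `g` and `h` lie in the same rational conjugacy class of the finite group `G`: `h` is conjugate
to a power `g ^ m` with `m` prime to `|G|`. -/
def RationallyConj {G : Type*} [Group G] [Finite G] (g h : G) : Prop :=
  ∃ m : ℕ, m.Coprime (Nat.card G) ∧ IsConj (g ^ m) h

/-- `G_n(u, g) = {a ∈ G | (a u⁻¹)^n = a^n = g}`. -/
def rootSet {G : Type*} [Group G] (n : ℕ) (u g : G) : Set G :=
  {a | (a * u⁻¹) ^ n = a ^ n ∧ a ^ n = g}

/-- `ζ_n : C(u) → ℤ ⊆ ℂ`, `g ↦ |G_n(u, g)|`. -/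
def zetaFun {G : Type*} [Group G] (n : ℕ) (u : G) (g : centralizerOf u) : ℂ :=
  ((rootSet n u (g : G)).ncard : ℂ)

end Characters

end

/-! Everything rests on two facts. Computing traces on the induced module gives ν_n(χ_η) = |C|⁻¹ ∑_c
ζ_n(c) η(c) (`hopfIndicator_doubleRep`). Since ζ_n is real, the indicators are thus the conjugates
of the multiplicities ⟨ζ_n, η⟩, and integral indicators make the class function ζ_n a virtual
character.

The second fact is that indicators are algebraic integers
(`DrinfeldDouble.isIntegral_hopfIndicator`). On V^{⊗n} the integral acts as an idempotent commuting
with the cyclic shift. Following it by the shift gives an operator whose nonzero eigenvalues are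
roots of unity, and whose trace is the indicator because the shift turns a tensor product of
operators into their composition.

The rest is Galois theory. A combination f of characters with rational coefficients satisfies f(g^m)
= p(ω^m) for a rational polynomial p depending on g, so f(g^m) = f(g) when f(g) is rational and m is
prime to the group order. This gives 2 → 4, and 3 → 4 by restriction to ⟨g⟩. Conversely, constancy
along such powers makes all multiplicities Galois invariant, hence rational. This gives 4 → 3 and,
with integrality, 4 → 1. -/

/-! ### Rational polynomials at roots of unity. -/

open Polynomial in
/-- A rational polynomial taking a rational value at a primitive root of unity takes the same value
at all its Galois conjugates. -/
theorem IsPrimitiveRoot.aeval_pow_eq_of_aeval_eq {N : ℕ} (hN : 0 < N) {ω : ℂ}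
    (hω : IsPrimitiveRoot ω N) {m : ℕ} (hm : m.Coprime N) {p : ℚ[X]} {q : ℚ}
    (h : aeval ω p = (q : ℂ)) : aeval (ω ^ m) p = (q : ℂ) := by
  have h0 : aeval ω (p - C q) = 0 := by simp [h]
  have h1 := minpoly.dvd ℚ ω h0
  -- ω and ω ^ m have the same minimal polynomial, the `N`-th cyclotomic polynomial.
  rw [← cyclotomic_eq_minpoly_rat hω hN,
    cyclotomic_eq_minpoly_rat (hω.pow_of_coprime m hm) hN] at h1
  have h2 := (minpoly.dvd_iff).1 h1
  simpa [sub_eq_zero] using h2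

open Polynomial in
/-- A rational polynomial with the same value at all primitive `N`-th roots of unity has a rational
value there. -/
theorem IsPrimitiveRoot.exists_rat_of_aeval_pow_eq {N : ℕ} (hN : 0 < N) {ω : ℂ}
    (hω : IsPrimitiveRoot ω N) {p : ℚ[X]}
    (h : ∀ m : ℕ, m.Coprime N → aeval (ω ^ m) p = aeval ω p) : ∃ q : ℚ, aeval ω p = (q : ℂ) := by
  have : NeZero N := ⟨hN.ne'⟩
  have : IsCyclotomicExtension {N} ℚ (IntermediateField.adjoin ℚ {ω}) := by
    change IsCyclotomicExtension {N} ℚ (IntermediateField.adjoin ℚ {ω}).toSubalgebra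
    rw [IntermediateField.adjoin_simple_toSubalgebra_of_isAlgebraic
      (hω.isIntegral hN).tower_top.isAlgebraic]
    exact hω.adjoin_isCyclotomicExtension ℚ
  have : IsGalois ℚ (IntermediateField.adjoin ℚ {ω}) :=
    IsCyclotomicExtension.isGalois {N} ℚ _
  have : FiniteDimensional ℚ (IntermediateField.adjoin ℚ {ω}) :=
    IsCyclotomicExtension.finiteDimensional {N} ℚ _
  set w : IntermediateField.adjoin ℚ {ω} := IntermediateField.AdjoinSimple.gen ℚ ω with hw
  have hwω : ((w : IntermediateField.adjoin ℚ {ω}) : ℂ) = ω :=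
    IntermediateField.AdjoinSimple.coe_gen ℚ ω
  have hprim : IsPrimitiveRoot w N := by
    rw [← hwω] at hω
    exact IsPrimitiveRoot.coe_submonoidClass_iff.1 hω
  have hcoe : ∀ z : IntermediateField.adjoin ℚ {ω},
      ((aeval z p : IntermediateField.adjoin ℚ {ω}) : ℂ) =
      aeval (z : ℂ) p := fun z => by
    exact (Polynomial.aeval_algebraMap_apply ℂ z p).symm
  -- Every automorphism of ℚ(ω) sends ω to some ω ^ m with m prime to `N`, so the value is fixed by
  -- the Galois group.
  have hmem : aeval w p ∈ (⊥ : IntermediateField ℚ (IntermediateField.adjoin ℚ {ω})) := by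
    rw [IsGalois.mem_bot_iff_fixed]
    intro f
    obtain ⟨m, -, hm, hmw⟩ := (hprim.isPrimitiveRoot_iff).1
      (hprim.map_of_injective (f := f) f.injective)
    rw [← Polynomial.aeval_algHom_apply]
    apply Subtype.ext
    rw [hcoe, hcoe, ← hmw, hwω]
    simpa [hwω] using h m hm
  obtain ⟨q, hq⟩ := IntermediateField.mem_bot.1 hmem
  refine ⟨q, ?_⟩
  have := congrArg (fun z : IntermediateField.adjoin ℚ {ω} => (z : ℂ)) hq
  simp only [hcoe, hwω] at this
  rw [← this]
  simp

/-! ### Characters as polynomials in a root of unity. -/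

/-- The powers of a linear endomorphism `T` with `T ^ N = 1` have traces
`∑ c k * ω ^ (k * m)`, where `c k` is the multiplicity of the eigenvalue `ω ^ k`. -/
theorem LinearMap.exists_trace_pow_eq_sum {V : Type*} [AddCommGroup V] [Module ℂ V]
    [FiniteDimensional ℂ V] {N : ℕ} (hN : 0 < N) {ω : ℂ} (hω : IsPrimitiveRoot ω N)
    (T : Module.End ℂ V) (hT : T ^ N = 1) :
    ∃ c : ℕ → ℕ, ∀ m : ℕ, LinearMap.trace ℂ V (T ^ m) =
      ∑ k ∈ Finset.range N, (c k : ℂ) * ω ^ (k * m) := by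
  have hN0 : (N : ℂ) ≠ 0 := by exact_mod_cast hN.ne'
  have hω0 : ω ≠ 0 := hω.ne_zero hN.ne'
  -- `E k` is the projection onto the ω ^ k-eigenspace of `T`, obtained by discrete Fourier
  -- inversion.
  let E : ℕ → Module.End ℂ V := fun k =>
    (N : ℂ)⁻¹ • ∑ j ∈ Finset.range N, ((ω ^ (k * j))⁻¹) • T ^ j
  have hTE : ∀ k, T * E k = ω ^ k • E k := by
    intro k
    -- The summand has period `N` in j, so shifting the index does not change the sum.
    have key : ∑ j ∈ Finset.range N, ((ω ^ (k * (j + 1)))⁻¹) • T ^ (j + 1) =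
        ∑ j ∈ Finset.range N, ((ω ^ (k * j))⁻¹) • T ^ j := by
      have h1 := Finset.sum_range_succ (fun j : ℕ => ((ω ^ (k * j))⁻¹) • T ^ j) N
      have h2 := Finset.sum_range_succ' (fun j : ℕ => ((ω ^ (k * j))⁻¹) • T ^ j) N
      rw [h1] at h2
      have h3 : ((ω ^ (k * N))⁻¹) • T ^ N = ((ω ^ (k * 0))⁻¹) • T ^ 0 := by
        rw [hT, mul_comm k N, pow_mul, hω.pow_eq_one]; simp
      rw [h3] at h2
      exact (add_right_cancel h2).symm
    simp only [E, mul_smul_comm, Finset.mul_sum]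
    rw [smul_comm, ← key, Finset.smul_sum (r := ω ^ k)]
    refine congrArg _ (Finset.sum_congr rfl fun j _ => ?_)
    rw [smul_smul, pow_succ' T]
    congr 1
    rw [mul_add, mul_one, pow_add]
    field_simp
  have hTE' : ∀ k m, T ^ m * E k = ω ^ (k * m) • E k := by
    intro k m
    induction m with
    | zero => simp
    | succ m ih =>
      rw [pow_succ', mul_assoc, ih, mul_smul_comm, hTE, smul_smul, mul_add, mul_one, pow_add]
  have hidem : ∀ k, IsIdempotentElem (E k) := by
    intro k
    change E k * E k = E k
    conv_lhs => enter [1]; simp only [E]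
    rw [smul_mul_assoc, Finset.sum_mul]
    simp only [smul_mul_assoc, hTE', smul_smul]
    rw [Finset.sum_congr rfl fun j _ => by
      rw [inv_mul_cancel₀ (pow_ne_zero (k * j) hω0), one_smul], Finset.sum_const,
      Finset.card_range, ← Nat.cast_smul_eq_nsmul ℂ, smul_smul, inv_mul_cancel₀ hN0, one_smul]
  have hsum : ∑ k ∈ Finset.range N, E k = 1 := by
    simp only [E]
    rw [← Finset.smul_sum, Finset.sum_comm]
    simp only [← Finset.sum_smul]
    -- For 0 < j < N the coefficient of `T ^ j` is a full geometric sum over powers of a nontrivial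
    -- `N`-th root of unity, which vanishes.
    rw [Finset.sum_eq_single 0]
    · simp [← Nat.cast_smul_eq_nsmul ℂ, smul_smul, hN0]
    · intro j hj hj0
      have h1 : (ω ^ j)⁻¹ ≠ 1 := by
        rw [Ne, inv_eq_one]
        exact hω.pow_ne_one_of_pos_of_lt hj0 (Finset.mem_range.1 hj)
      have h2 : ∑ k ∈ Finset.range N, (ω ^ (k * j))⁻¹ = ∑ k ∈ Finset.range N, ((ω ^ j)⁻¹) ^ k :=
        Finset.sum_congr rfl fun k _ => by rw [mul_comm, pow_mul, inv_pow]
      rw [h2, geom_sum_eq h1, inv_pow, ← pow_mul, mul_comm, pow_mul, hω.pow_eq_one]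
      simp
    · simp [hN.ne']
  refine ⟨fun k => Module.finrank ℂ (LinearMap.range (E k)), fun m => ?_⟩
  have h1 : T ^ m = ∑ k ∈ Finset.range N, ω ^ (k * m) • E k := by
    rw [← mul_one (T ^ m), ← hsum, Finset.mul_sum]
    exact Finset.sum_congr rfl fun k _ => hTE' k m
  rw [h1, map_sum]
  refine Finset.sum_congr rfl fun k _ => ?_
  rw [map_smul, smul_eq_mul, mul_comm,
    ((LinearMap.isProj_range_iff_isIdempotentElem _).2 (hidem k)).trace]

open Polynomial in
/-- Over `ℚ`, the functions `f` on a group whose values `f (g ^ m)` are the values of a single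
rational polynomial (depending on `g`) at `ω ^ m`. -/
def cyclotomicFunctions (G : Type*) [Group G] (ω : ℂ) : Submodule ℚ (G → ℂ) where
  carrier := {f | ∀ g : G, ∃ p : ℚ[X], ∀ m : ℕ, f (g ^ m) = aeval (ω ^ m) p}
  zero_mem' _ := ⟨0, by simp⟩
  add_mem' {a b} ha hb g := by
    obtain ⟨p, hp⟩ := ha g
    obtain ⟨q, hq⟩ := hb g
    exact ⟨p + q, fun m => by simp [hp, hq]⟩
  smul_mem' c a ha g := by
    obtain ⟨p, hp⟩ := ha g
    exact ⟨c • p, fun m => by simp [hp]⟩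

section

variable {G : Type*} [Group G] [Finite G] {ω : ℂ}

-- The coefficients of the polynomial are the eigenvalue multiplicities of ρ g. They do not depend
-- on m, so one polynomial serves all powers of g.
open Polynomial in
theorem Representation.character_mem_cyclotomicFunctions {V : Type*} [AddCommGroup V] [Module ℂ V]
    [FiniteDimensional ℂ V] (hω : IsPrimitiveRoot ω (Nat.card G)) (ρ : Representation ℂ G V) :
    ρ.character ∈ cyclotomicFunctions G ω := by
  intro g
  obtain ⟨c, hc⟩ := LinearMap.exists_trace_pow_eq_sum Nat.card_pos hω (ρ g)
    (by rw [← map_pow, pow_card_eq_one', map_one])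
  refine ⟨∑ k ∈ Finset.range (Nat.card G), C (c k : ℚ) * X ^ k, fun m => ?_⟩
  rw [Representation.character, map_pow, hc]
  simp [← pow_mul, mul_comm m]

-- With N = |G|, both g⁻¹ = g ^ (N - 1) and conj ω = ω ^ (N - 1) hold, and conjugation commutes with
-- evaluating a rational polynomial.
open Polynomial in
theorem Representation.character_inv {V : Type*} [AddCommGroup V] [Module ℂ V]
    [FiniteDimensional ℂ V] (ρ : Representation ℂ G V) (g : G) :
    ρ.character g⁻¹ = (starRingEnd ℂ) (ρ.character g) := by
  have hω := Complex.isPrimitiveRoot_exp (Nat.card G) Nat.card_pos.ne'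
  set ω := Complex.exp (2 * Real.pi * Complex.I / (Nat.card G : ℂ))
  obtain ⟨p, hp⟩ := ρ.character_mem_cyclotomicFunctions hω g
  have hg : g⁻¹ = g ^ (Nat.card G - 1) := by
    rw [inv_eq_iff_mul_eq_one, ← pow_succ', Nat.sub_add_cancel Nat.card_pos, pow_card_eq_one']
  have hw : ω ^ (Nat.card G - 1) = (starRingEnd ℂ) ω := by
    have h1 : ω * ω ^ (Nat.card G - 1) = 1 := by
      rw [← pow_succ', Nat.sub_add_cancel Nat.card_pos, hω.pow_eq_one]
    rw [← Complex.inv_eq_conj (hω.norm'_eq_one Nat.card_pos.ne')]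
    exact eq_inv_of_mul_eq_one_right h1
  have h1 := hp 1
  rw [pow_one, pow_one] at h1
  rw [hg, hp, h1, hw]
  exact Polynomial.aeval_algHom_apply ((Complex.conjAe : ℂ →ₐ[ℝ] ℂ).restrictScalars ℚ) ω p

/-- Rational-valued functions with cyclotomic values are constant along powers prime to `|G|`. -/
theorem apply_pow_eq_of_mem_cyclotomicFunctions (hω : IsPrimitiveRoot ω (Nat.card G))
    {f : G → ℂ} (hf : f ∈ cyclotomicFunctions G ω) {g : G} {q : ℚ} (hq : f g = q) {m : ℕ}
    (hm : m.Coprime (Nat.card G)) : f (g ^ m) = f g := by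
  obtain ⟨p, hp⟩ := hf g
  have h1 := hp 1
  rw [pow_one, pow_one] at h1
  rw [hp, hq]
  exact hω.aeval_pow_eq_of_aeval_eq Nat.card_pos hm (h1.symm.trans hq)

end

/-! ### Orthogonality and completeness of the irreducible characters. -/

section

open scoped MonoidAlgebra

/-- Every finite-dimensional simple `ℂ[G]`-module affords an element of `irrChars G`. -/
theorem trace_lsmul_mem_irrChars {G : Type*} [Group G] (S : Type*) [AddCommGroup S]
    [Module ℂ S] [Module ℂ[G] S]
    [IsScalarTower ℂ ℂ[G] S] [FiniteDimensional ℂ S] [IsSimpleModule ℂ[G] S] :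
    (fun g : G => LinearMap.trace ℂ S
      (Algebra.lsmul ℂ ℂ S (MonoidAlgebra.single g 1 : ℂ[G]))) ∈ irrChars G := by
  -- The carrier of a member of `irrChars` lies in `Type`, so the action is transported to
  -- coordinates.
  let b : S ≃ₗ[ℂ] (Fin (Module.finrank ℂ S) → ℂ) := (Module.finBasis ℂ S).equivFun
  let φ : ℂ[G] →ₐ[ℂ] Module.End ℂ (Fin (Module.finrank ℂ S) → ℂ) :=
    (b.conjAlgEquiv ℂ : _ →ₐ[ℂ] _).comp (Algebra.lsmul ℂ ℂ S)
  let σ : Representation ℂ G (Fin (Module.finrank ℂ S) → ℂ) := (MonoidAlgebra.lift ℂ _ G).symm φ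
  have hσ : σ.asAlgebraHom = φ := (MonoidAlgebra.lift ℂ _ G).apply_symm_apply φ
  refine ⟨Fin (Module.finrank ℂ S) → ℂ, inferInstance, inferInstance, inferInstance, σ, ?_, ?_⟩
  · rw [Representation.irreducible_iff_isSimpleModule_asModule]
    let e : σ.asModule ≃ₗ[ℂ[G]] S :=
      { (σ.asModuleEquiv.trans b.symm) with
        map_smul' := fun r x => by
          change b.symm (σ.asModuleEquiv (r • x)) = r • b.symm (σ.asModuleEquiv x)
          rw [Representation.asModuleEquiv_map_smul, hσ]
          simp [φ] }
    exact IsSimpleModule.congr e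
  · funext g
    change _ = LinearMap.trace ℂ _ (b.conj (Algebra.lsmul ℂ ℂ S (MonoidAlgebra.single g 1 : ℂ[G])))
    rw [LinearMap.trace_conj']

variable {G : Type*} [Group G] [Finite G]

/-- A class function orthogonal to all irreducible characters vanishes. -/
theorem eq_zero_of_forall_cfInner_eq_zero (f : G → ℂ) (hf : ∀ g h, f (h * g * h⁻¹) = f g)
    (h0 : ∀ χ ∈ irrChars G, cfInner f χ = 0) : f = 0 := by
  have := Fintype.ofFinite G
  have hcard : (Nat.card G : ℂ) ≠ 0 := by exact_mod_cast Nat.card_pos.ne'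
  have : NeZero (Nat.card G : ℂ) := ⟨hcard⟩
  -- This element is central because f is a class function. Its trace on a simple module with
  -- character χ is |G|⟨f, χ⟩, by χ(g⁻¹) = conj χ(g).
  let z : ℂ[G] := ∑ g : G, MonoidAlgebra.single g⁻¹ (f g)
  have hz : ∀ g, z * MonoidAlgebra.single g 1 = MonoidAlgebra.single g 1 * z := by
    intro g
    simp only [z, Finset.sum_mul, Finset.mul_sum, MonoidAlgebra.single_mul_single, mul_one, one_mul]
    refine Fintype.sum_equiv (MulAut.conj g⁻¹).toEquiv _ _ fun x => ?_
    have h1 := hf x g⁻¹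
    simp only [inv_inv] at h1
    simp [← h1, mul_assoc]
  have hcomm : ∀ r, z * r = r * z := by
    intro r
    induction r using MonoidAlgebra.induction_linear with
    | zero => simp
    | add r s hr hs => rw [mul_add, add_mul, hr, hs]
    | single g c =>
      have : (MonoidAlgebra.single g c : ℂ[G]) = c • MonoidAlgebra.single g 1 := by simp
      rw [this, mul_smul_comm, smul_mul_assoc, hz]
  have hkill : ∀ S : Submodule ℂ[G] ℂ[G], IsSimpleModule ℂ[G] S → ∀ s ∈ S, z * s = 0 := by
    intro S hS s hs
    have : FiniteDimensional ℂ S :=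
      Module.Finite.of_injective (S.subtype.restrictScalars ℂ) S.subtype_injective
    let Z : Module.End ℂ[G] S :=
      { toFun := fun x => z • x
        map_add' := fun x y => smul_add _ _ _
        map_smul' := fun r x => by
          simp only [RingHom.id_apply]
          rw [← mul_smul, ← mul_smul, hcomm] }
    -- Schur's lemma: z acts on S by a scalar c, and the vanishing trace c · dim S forces c = 0.
    obtain ⟨c, hc⟩ := (IsSimpleModule.algebraMap_end_bijective_of_isAlgClosed
      (A := ℂ[G]) (V := S) ℂ).2 Z
    have hcz : Algebra.lsmul ℂ ℂ S z = c • (1 : Module.End ℂ S) := by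
      ext1 x
      have := congrArg (fun F : Module.End ℂ[G] S => F x) hc
      simpa [Z] using this.symm
    have htr : LinearMap.trace ℂ S (Algebra.lsmul ℂ ℂ S z) = 0 := by
      have hχ := trace_lsmul_mem_irrChars (G := G) S
      have h1 := h0 _ hχ
      obtain ⟨W, _, _, _, ρ, -, hρ⟩ := hχ
      rw [hρ, cfInner, mul_eq_zero_iff_left (inv_ne_zero hcard), finsum_eq_sum_of_fintype] at h1
      simp only [← Representation.character_inv] at h1
      simp only [← hρ] at h1
      rw [← h1]
      simp only [z, map_sum]
      refine Finset.sum_congr rfl fun g _ => ?_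
      have : (MonoidAlgebra.single g⁻¹ (f g) : ℂ[G]) = f g • MonoidAlgebra.single g⁻¹ 1 := by simp
      rw [this, map_smul, map_smul, smul_eq_mul]
    have := IsSimpleModule.nontrivial ℂ[G] S
    have hc0 : c = 0 := by
      rw [hcz, map_smul, LinearMap.trace_one, smul_eq_mul] at htr
      exact (mul_eq_zero.1 htr).resolve_right (by exact_mod_cast Module.finrank_pos.ne')
    rw [hc0, zero_smul] at hcz
    have := congrArg (fun F : Module.End ℂ S => ((F ⟨s, hs⟩ : S) : ℂ[G])) hcz
    simpa using this
  have hz0 : z = 0 := by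
    have hle : (⊤ : Submodule ℂ[G] ℂ[G]) ≤ LinearMap.ker
        ({ toFun := fun x => z * x
           map_add' := mul_add z
           map_smul' := fun r x => by
            simp only [RingHom.id_apply, smul_eq_mul]
            rw [← mul_assoc, ← mul_assoc, hcomm] } : ℂ[G] →ₗ[ℂ[G]] ℂ[G]) := by
      -- By Maschke's theorem the simple submodules span ℂ[G], so z kills 1 and is zero.
      rw [← IsSemisimpleModule.sSup_simples_eq_top ℂ[G] ℂ[G]]
      exact sSup_le fun S hS s hs => hkill S hS s hs
    simpa using hle (Submodule.mem_top (x := (1 : ℂ[G])))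
  classical
  funext g
  have h2 := congrArg (fun r : ℂ[G] => r.coeff g⁻¹) hz0
  have h3 : z.coeff g⁻¹ = f g := by
    simp [z, MonoidAlgebra.coeff_sum, Finsupp.single_apply]
  rw [← h3]
  exact h2

theorem cfInner_eq_sum [Fintype G] (f g : G → ℂ) :
    cfInner f g = (Nat.card G : ℂ)⁻¹ * ∑ x, f x * (starRingEnd ℂ) (g x) := by
  rw [cfInner, finsum_eq_sum_of_fintype]

/-- `cfInner` as a linear functional of its first argument. -/
noncomputable def cfInnerLeft (ψ : G → ℂ) : (G → ℂ) →ₗ[ℂ] ℂ where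
  toFun φ := cfInner φ ψ
  map_add' φ φ' := by
    have := Fintype.ofFinite G
    simp [cfInner_eq_sum, add_mul, Finset.sum_add_distrib, mul_add]
  map_smul' c φ := by
    have := Fintype.ofFinite G
    simp only [cfInner_eq_sum, Pi.smul_apply, smul_eq_mul, RingHom.id_apply, mul_assoc,
      ← Finset.mul_sum]
    ring

theorem irrChars_orthonormal {χ ψ : G → ℂ} (hχ : χ ∈ irrChars G) (hψ : ψ ∈ irrChars G) :
    (χ = ψ → cfInner χ ψ = 1) ∧ (χ ≠ ψ → cfInner χ ψ = 0) := by
  have := Fintype.ofFinite G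
  have hcard : (Nat.card G : ℂ) ≠ 0 := by exact_mod_cast Nat.card_pos.ne'
  obtain ⟨V, _, _, _, ρ, hρ, rfl⟩ := hχ
  obtain ⟨W, _, _, _, σ, hσ, rfl⟩ := hψ
  have := invertibleOfNonzero hcard
  have h := Representation.char_orthonormal ρ σ
  simp only [Representation.character_inv] at h
  rw [cfInner_eq_sum, h]
  constructor
  -- Equality of characters does not yet provide an isomorphism, so ρ is paired with itself.
  · intro hne
    have h1 := Representation.char_orthonormal ρ ρ
    rw [if_pos ⟨Representation.Equiv.refl ρ⟩] at h1
    rw [← h, ← hne]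
    simpa only [Representation.character_inv, Nat.cast_one] using h1
  · intro hne
    rw [if_neg]
    rintro ⟨e⟩
    exact hne (Representation.char_iso e).symm

/-- Orthonormality makes the irreducible characters linearly independent in the finite-dimensional
space of functions on G. -/
theorem irrChars_finite : (irrChars G).Finite := by
  have hli : LinearIndependent ℂ (fun χ : irrChars G => (χ : G → ℂ)) := by
    rw [linearIndependent_iff']
    intro s c hc χ hχ
    have h1 := congrArg (cfInnerLeft (χ : G → ℂ)) hc
    rw [map_sum, map_zero, Finset.sum_eq_single χ] at h1
    · rw [map_smul] at h1
      change c χ * cfInner χ.1 χ.1 = 0 at h1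
      rwa [(irrChars_orthonormal χ.2 χ.2).1 rfl, mul_one] at h1
    · intro ψ _ hne
      rw [map_smul]
      change c ψ * cfInner ψ.1 χ.1 = 0
      rw [(irrChars_orthonormal ψ.2 χ.2).2 (fun h => hne (Subtype.ext h)), mul_zero]
    · exact fun h => (h hχ).elim
  have := hli.finite
  exact Set.toFinite _

/-- The expansion of a class function in irreducible characters. -/
theorem eq_sum_cfInner_smul (f : G → ℂ) (hf : ∀ g h, f (h * g * h⁻¹) = f g) :
    f = ∑ χ ∈ (irrChars_finite (G := G)).toFinset, cfInner f χ • χ := by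
  rw [← sub_eq_zero]
  refine eq_zero_of_forall_cfInner_eq_zero _ (fun g h => ?_) fun ψ hψ => ?_
  · simp only [Pi.sub_apply, Finset.sum_apply, Pi.smul_apply, hf]
    refine congrArg _ (Finset.sum_congr rfl fun χ hχ => ?_)
    obtain ⟨V, _, _, _, ρ, -, rfl⟩ := (Set.Finite.mem_toFinset _).1 hχ
    rw [Representation.char_conj]
  · change cfInnerLeft ψ _ = 0
    rw [map_sub, map_sum, Finset.sum_eq_single ψ]
    · rw [map_smul]
      change cfInner f ψ - cfInner f ψ * cfInner ψ ψ = 0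
      rw [(irrChars_orthonormal hψ hψ).1 rfl, mul_one, sub_self]
    · intro χ hχ hne
      rw [map_smul]
      change cfInner f χ * cfInner χ ψ = 0
      rw [(irrChars_orthonormal ((Set.Finite.mem_toFinset _).1 hχ) hψ).2 hne, mul_zero]
    · exact fun h => (h ((Set.Finite.mem_toFinset _).2 hψ)).elim

end

/-! ### Tensor powers, the cyclic shift and integral traces. -/

section TensorPower

/-- Each eigenvalue satisfies μ ^ (N + 1) = μ, so it is zero or a root of unity. -/
theorem Matrix.isIntegral_trace_of_pow_succ_eq_self {I : Type*} [Fintype I] [DecidableEq I]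
    {Q : Matrix I I ℂ} {N : ℕ} (hN : 0 < N) (h : Q ^ (N + 1) = Q) : IsIntegral ℤ Q.trace := by
  rw [Matrix.trace_eq_sum_roots_charpoly]
  refine IsIntegral.multiset_sum fun μ hμ => ?_
  have h1 : Module.End.HasEigenvalue (Matrix.toLin' Q) μ := by
    rw [Module.End.hasEigenvalue_iff_isRoot_charpoly, Matrix.charpoly_toLin']
    exact Polynomial.isRoot_of_mem_roots hμ
  obtain ⟨v, hv⟩ := h1.exists_hasEigenvector
  have h2 := hv.pow_apply (N + 1)
  rw [← Matrix.toLin'_pow, h, hv.apply_eq_smul, ← sub_eq_zero, ← sub_smul] at h2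
  have h3 : μ - μ ^ (N + 1) = 0 := (smul_eq_zero.1 h2).resolve_right hv.2
  by_cases h0 : μ = 0
  · rw [h0]; exact isIntegral_zero
  · have h4 : μ ^ N = 1 := by
      refine mul_right_cancel₀ h0 ?_
      rw [← pow_succ, one_mul]
      exact (sub_eq_zero.1 h3).symm
    exact IsIntegral.of_pow hN (h4 ▸ isIntegral_one)

/-- An idempotent matrix twisted by a permutation under which it is invariant has integral
trace. -/
theorem Matrix.isIntegral_trace_submatrix_perm {I : Type*} [Fintype I] [DecidableEq I]
    {P : Matrix I I ℂ} (hP : P * P = P) (τ : Equiv.Perm I) (hτ : P.submatrix τ τ = P) :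
    IsIntegral ℤ (P.submatrix id τ).trace := by
  have hinv : ∀ i j, P (τ.symm i) j = P i (τ j) := by
    intro i j
    have := congrFun (congrFun hτ (τ.symm i)) j
    simpa using this.symm
  -- P commutes with the permutation matrix and is idempotent, so powers only move the permutation.
  -- The exponent starts at 1, since the zeroth power is the identity and not P.
  have key : ∀ k : ℕ,
      (P.submatrix id τ) ^ (k + 1) = P.submatrix id (τ ^ (k + 1) : Equiv.Perm I) := by
    intro k
    induction k with
    | zero => simp
    | succ k ih =>
      rw [pow_succ', ih, pow_succ' τ (k + 1)]
      ext i j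
      have h1 := congrFun (congrFun hP (τ.symm i)) ((τ ^ (k + 1)) j)
      simp only [Matrix.mul_apply, hinv] at h1
      simpa [Matrix.mul_apply] using h1
  refine Matrix.isIntegral_trace_of_pow_succ_eq_self (orderOf_pos τ) ?_
  rw [key, pow_succ, pow_orderOf_eq_one, one_mul]

/-- The matrix of the tensor product of the operators with matrices `A k`. -/
def tensorMatrix {I κ : Type*} [Fintype κ] (A : κ → Matrix I I ℂ) : Matrix (κ → I) (κ → I) ℂ :=
  Matrix.of fun f g => ∏ k, A k (f k) (g k)

theorem tensorMatrix_mul {I κ : Type*} [Fintype I] [Fintype κ] [DecidableEq κ]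
    (A B : κ → Matrix I I ℂ) :
    tensorMatrix A * tensorMatrix B = tensorMatrix (fun k => A k * B k) := by
  ext f g
  simp only [tensorMatrix, Matrix.mul_apply, Matrix.of_apply, Finset.prod_univ_sum,
    Fintype.piFinset_univ, Finset.prod_mul_distrib]

theorem tensorMatrix_eq_zero {I κ : Type*} [Fintype κ] {A : κ → Matrix I I ℂ} {k : κ}
    (h : A k = 0) : tensorMatrix A = 0 := by
  ext f g
  simp only [tensorMatrix, Matrix.of_apply, Matrix.zero_apply]
  exact Finset.prod_eq_zero (Finset.mem_univ k) (by rw [h, Matrix.zero_apply])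

/-- Precomposition with a permutation of the index set. -/
def permFun {κ : Type*} (I : Type*) (σ : Equiv.Perm κ) : Equiv.Perm (κ → I) :=
  σ.symm.arrowCongr (Equiv.refl I)

theorem permFun_apply {κ I : Type*} (σ : Equiv.Perm κ) (f : κ → I) : permFun I σ f = f ∘ σ := rfl

/-- Permuting the factors and the entries of the index tuples together only reorders the product. -/
theorem tensorMatrix_submatrix {I κ : Type*} [Fintype κ] (σ : Equiv.Perm κ)
    (A : κ → Matrix I I ℂ) :
    (tensorMatrix (fun k => A (σ k))).submatrix (permFun I σ) (permFun I σ) = tensorMatrix A := by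
  ext f g
  simp only [tensorMatrix, Matrix.submatrix_apply, Matrix.of_apply, permFun_apply,
    Function.comp_apply]
  exact Equiv.prod_comp σ (fun k => A k (f k) (g k))

/-- A sum over paths from i to j with interior vertices f: the `k`-th edge starts at entry k of
`Fin.cons i f` and ends at entry k of `Fin.snoc f j`. -/
theorem Matrix.list_prod_ofFn_apply {I : Type*} [Fintype I] [DecidableEq I] {m : ℕ}
    (A : Fin (m + 1) → Matrix I I ℂ) (i j : I) :
    (List.ofFn A).prod i j = ∑ f : Fin m → I, ∏ k,
      A k ((Fin.cons i f : Fin (m + 1) → I) k) ((Fin.snoc f j : Fin (m + 1) → I) k) := by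
  induction m generalizing i with
  | zero =>
    simp [Fin.snoc]
  | succ m ih =>
    rw [List.ofFn_succ, List.prod_cons, Matrix.mul_apply]
    simp only [ih, Finset.mul_sum]
    rw [← Fintype.sum_prod_type', ← (Fin.consEquiv (fun _ => I)).sum_comp]
    refine Finset.sum_congr rfl fun p _ => ?_
    have h : (Fin.snoc ((Fin.consEquiv (fun _ => I)) p) j : Fin (m + 2) → I) =
        Fin.cons p.1 (Fin.snoc p.2 j : Fin (m + 1) → I) :=
      (Fin.cons_snoc_eq_snoc_cons (β := I) p.1 p.2 j).symm
    rw [h]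
    conv_rhs => rw [Fin.prod_univ_succ]
    rfl

/-- The trace of a tensor product of operators composed with the cyclic shift. -/
theorem trace_tensorMatrix_submatrix_finRotate {I : Type*} [Fintype I] [DecidableEq I] {m : ℕ}
    (A : Fin (m + 1) → Matrix I I ℂ) :
    ((tensorMatrix A).submatrix id (permFun I (finRotate (m + 1)))).trace =
      (List.ofFn A).prod.trace := by
  simp only [Matrix.trace, Matrix.diag_apply, Matrix.list_prod_ofFn_apply]
  rw [← Fintype.sum_prod_type', ← (Fin.consEquiv (fun _ => I)).sum_comp]
  refine Finset.sum_congr rfl fun p _ => ?_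
  -- On a closed path, the endpoints of the edges are the starting points rotated by one.
  rw [Fin.snoc_eq_cons_rotate]
  rfl

/-- Rotation moves the first factor to the end, which conjugates the product. -/
theorem List.prod_ofFn_comp_finRotate_eq_one_iff {G : Type*} [Group G] {m : ℕ}
    (a : Fin (m + 1) → G) :
    (List.ofFn fun k => a (finRotate (m + 1) k)).prod = 1 ↔ (List.ofFn a).prod = 1 := by
  have h1 : (fun k => a (finRotate (m + 1) k)) =
      (Fin.snoc (Fin.tail a) (a 0) : Fin (m + 1) → G) := by
    rw [Fin.snoc_eq_cons_rotate, Fin.cons_self_tail]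
  have h2 : List.ofFn (Fin.snoc (Fin.tail a) (a 0) : Fin (m + 1) → G) =
      List.ofFn (Fin.tail a) ++ [a 0] := by
    rw [List.ofFn_succ']
    simp
  rw [h1, h2, List.ofFn_succ (f := a), List.prod_append, List.prod_singleton, List.prod_cons,
    mul_eq_one_iff_eq_inv, eq_comm, inv_eq_iff_mul_eq_one]
  rfl

end TensorPower

/-! ### Sweedler powers, the integral and integrality of the indicators. -/

namespace DrinfeldDouble

variable {G : Type*} [Fintype G] [DecidableEq G] [Group G]

theorem sweedlerPower_zero_e (g h : G) :
    sweedlerPower 0 (e g h) = if g = 1 then (1 : DrinfeldDouble G) else 0 := by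
  rw [sweedlerPower, pow_zero, LinearMap.convOne_def]
  simp only [LinearMap.comp_apply, counit_e]
  split_ifs <;> simp

theorem sweedlerPower_succ_e (n : ℕ) (g h : G) :
    sweedlerPower (n + 1) (e g h) =
      ∑ a, (e a h * sweedlerPower n (e (a⁻¹ * g) h) : DrinfeldDouble G) := by
  rw [sweedlerPower, pow_succ', LinearMap.convMul_def]
  simp only [LinearMap.comp_apply, comul_e, map_sum, TensorProduct.map_tmul,
    LinearMap.mul'_apply]
  rfl

/-- The iterated coproduct with its factors kept apart, as needed for the comparison with the action
on V^{⊗n}; the closed form `sweedlerPower_e` serves to compute the indicators. -/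
theorem sweedlerPower_e_eq_sum_list_prod (n : ℕ) (g h : G) :
    sweedlerPower n (e g h) = ∑ a : Fin n → G,
      if (List.ofFn a).prod = g then (List.ofFn fun k => e (a k) h : List (DrinfeldDouble G)).prod
        else 0 := by
  induction n generalizing g with
  | zero => simp [sweedlerPower_zero_e, eq_comm]
  | succ n ih =>
    rw [sweedlerPower_succ_e]
    simp only [ih, Finset.mul_sum]
    rw [← Fintype.sum_prod_type', ← (Fin.consEquiv (fun _ => G)).sum_comp]
    refine Finset.sum_congr rfl fun p _ => ?_
    have h1 : (List.ofFn ((Fin.consEquiv (fun _ => G)) p)).prod = g ↔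
        (List.ofFn p.2).prod = p.1⁻¹ * g := by
      rw [List.ofFn_succ, List.prod_cons, eq_inv_mul_iff_mul_eq]
      rfl
    simp only [h1]
    split_ifs
    · rw [List.ofFn_succ, List.prod_cons]
      rfl
    · simp

/-- The closed form of the Sweedler powers of the basis elements. -/
theorem sweedlerPower_e (n : ℕ) (g h : G) :
    sweedlerPower n (e g h) = ∑ a : G,
      if (a * h⁻¹) ^ n * h ^ n = g then (e a (h ^ n) : DrinfeldDouble G) else 0 := by
  induction n generalizing g with
  | zero =>
    rw [sweedlerPower_zero_e, one_def]
    simp only [pow_zero, mul_one, eq_comm (a := (1 : G))]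
    split_ifs <;> simp
  | succ n ih =>
    rw [sweedlerPower_succ_e]
    refine Finset.sum_congr rfl fun b _ => ?_
    -- Only this term has a nonzero product with e_b # h; the conjugates b, h⁻¹bh, … then telescope
    -- to (b h⁻¹) ^ (n + 1) h ^ (n + 1).
    rw [ih, Finset.mul_sum, Finset.sum_eq_single (h⁻¹ * b * h)]
    · have h1 : ((h⁻¹ * b * h * h⁻¹) ^ n * h ^ n = b⁻¹ * g) ↔
          ((b * h⁻¹) ^ (n + 1) * h ^ (n + 1) = g) := by
        rw [eq_inv_mul_iff_mul_eq]
        have h2 : h⁻¹ * b * h * h⁻¹ = h⁻¹ * (b * h⁻¹) * h⁻¹⁻¹ := by group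
        rw [h2, conj_pow, pow_succ', pow_succ']
        have h3 : b * (h⁻¹ * (b * h⁻¹) ^ n * h⁻¹⁻¹ * h ^ n) =
          b * h⁻¹ * (b * h⁻¹) ^ n * (h * h ^ n) := by group
        rw [h3]
      simp only [h1]
      split_ifs
      · rw [e_mul_e, if_pos (by group), pow_succ']
      · simp
    · intro a _ ha
      have hne : b ≠ h * a * h⁻¹ := by
        rintro rfl
        exact ha (by group)
      rw [mul_ite, mul_zero, e_mul_e, if_neg hne, ite_self]
    · simp

/-- The normalized integral of `D(G)` is unique. -/
theorem eq_of_isNormalizedIntegral {Λ : DrinfeldDouble G} (hΛ : IsNormalizedIntegral Λ) :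
    Λ = (Fintype.card G : ℂ)⁻¹ • ∑ h, e 1 h := by
  have hcard : (Fintype.card G : ℂ) ≠ 0 := by simp
  -- The explicit element Λ₀ has the mirror property Λ₀ x = ε(x) Λ₀ (`h2`), so Λ₀ Λ equals both
  -- ε(Λ₀) Λ and ε(Λ) Λ₀.
  have h1 := hΛ.1 ((Fintype.card G : ℂ)⁻¹ • ∑ h, e 1 h)
  have h2 : ∀ x : DrinfeldDouble G, (∑ h, e 1 h) * x =
      Coalgebra.counit (R := ℂ) x • ∑ h, (e 1 h : DrinfeldDouble G) := by
    intro x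
    induction x using induction with
    | h0 => simp
    | hadd x x' hx hx' => rw [mul_add, hx, hx', map_add, add_smul]
    | hsmul c x hx => rw [mul_smul_comm, hx, map_smul, smul_assoc]
    | he a k =>
      rw [Finset.sum_mul, counit_e]
      simp only [e_mul_e]
      have h3 : ∀ h : G, (1 = h * a * h⁻¹) ↔ a = 1 := fun h => by
        rw [eq_comm, conj_eq_one_iff]
      simp only [h3]
      split_ifs
      · rw [one_smul]
        exact Fintype.sum_equiv (Equiv.mulRight k) _ _ fun b => by simp
      · simp
  rw [smul_mul_assoc, h2, hΛ.2, one_smul] at h1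
  rw [h1]
  simp [counit_e, hcard]

theorem sweedlerPower_integral (n : ℕ) :
    sweedlerPower n ((Fintype.card G : ℂ)⁻¹ • ∑ h, (e 1 h : DrinfeldDouble G)) =
      (Fintype.card G : ℂ)⁻¹ • ∑ h, sweedlerPower n (e 1 h) := by
  simp only [sweedlerPower, map_smul, map_sum]

/-- For a matrix representation of `D(G)`, the matrix of the integral acting on the `n`-th tensor
power. -/
noncomputable def integralMatrix {I : Type*} [Fintype I] [DecidableEq I]
    (R : DrinfeldDouble G →ₐ[ℂ] Matrix I I ℂ) (n : ℕ) : Matrix (Fin n → I) (Fin n → I) ℂ :=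
  (Fintype.card G : ℂ)⁻¹ • ∑ h : G, ∑ a : Fin n → G,
    if (List.ofFn a).prod = 1 then tensorMatrix (fun k => R (e (a k) h)) else 0

/-- The summand for h times the summand for h' is the summand for h h', since a tuple a pairs only
with its conjugate h⁻¹ a h. Averaging over the group is then idempotent. -/
theorem integralMatrix_mul_self {I : Type*} [Fintype I] [DecidableEq I]
    (R : DrinfeldDouble G →ₐ[ℂ] Matrix I I ℂ) (n : ℕ) :
    integralMatrix R n * integralMatrix R n = integralMatrix R n := by
  have hcard : (Fintype.card G : ℂ) ≠ 0 := by simp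
  have key : ∀ h h' : G, (∑ a : Fin n → G,
      if (List.ofFn a).prod = 1 then tensorMatrix (fun k => R (e (a k) h)) else 0) *
      (∑ a : Fin n → G,
        if (List.ofFn a).prod = 1 then tensorMatrix (fun k => R (e (a k) h')) else 0) =
      ∑ a : Fin n → G,
        if (List.ofFn a).prod = 1 then tensorMatrix (fun k => R (e (a k) (h * h'))) else 0 := by
    intro h h'
    rw [Finset.sum_mul]
    refine Finset.sum_congr rfl fun a _ => ?_
    split_ifs with ha
    · rw [Finset.mul_sum, Finset.sum_eq_single (fun k => h⁻¹ * a k * h)]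
      · have h1 : (List.ofFn fun k => h⁻¹ * a k * h).prod = 1 := by
          have h2 : (List.ofFn fun k => h⁻¹ * a k * h) = (List.ofFn a).map (MulAut.conj h⁻¹) := by
            rw [List.map_ofFn]
            congr 1
            funext k
            simp
          rw [h2, ← map_list_prod, ha, map_one]
        rw [if_pos h1, tensorMatrix_mul]
        congr 1
        funext k
        rw [← map_mul, e_mul_e, if_pos (by group)]
      · intro b _ hb
        rw [mul_ite, mul_zero, tensorMatrix_mul]
        obtain ⟨k, hk⟩ := Function.ne_iff.1 hb
        rw [tensorMatrix_eq_zero (k := k), ite_self]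
        rw [← map_mul, e_mul_e, if_neg, map_zero]
        intro h3
        exact hk (by rw [h3]; group)
      · simp
    · simp
  rw [integralMatrix, smul_mul_smul_comm, Finset.sum_mul_sum]
  simp only [key]
  have h4 : ∀ h : G, ∑ h' : G, (∑ a : Fin n → G,
        if (List.ofFn a).prod = 1 then tensorMatrix (fun k => R (e (a k) (h * h'))) else 0) =
      ∑ h' : G, (∑ a : Fin n → G,
        if (List.ofFn a).prod = 1 then tensorMatrix (fun k => R (e (a k) h')) else 0) := fun h =>
    Fintype.sum_equiv (Equiv.mulLeft h) _ _ fun h' => rfl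
  simp only [h4]
  rw [Finset.sum_const, Finset.card_univ, ← Nat.cast_smul_eq_nsmul ℂ, smul_smul, mul_assoc,
    inv_mul_cancel₀ hcard, mul_one]

/-- The integral commutes with the cyclic shift, because the condition a₁⋯a_n = 1 is invariant under
rotation. -/
theorem integralMatrix_submatrix {I : Type*} [Fintype I] [DecidableEq I]
    (R : DrinfeldDouble G →ₐ[ℂ] Matrix I I ℂ) (m : ℕ) :
    (integralMatrix R (m + 1)).submatrix (permFun I (finRotate (m + 1)))
      (permFun I (finRotate (m + 1))) = integralMatrix R (m + 1) := by
  ext f g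
  simp only [integralMatrix, Matrix.submatrix_apply, Matrix.smul_apply, Matrix.sum_apply]
  congr 1
  refine Finset.sum_congr rfl fun h _ => ?_
  rw [← Equiv.sum_comp (permFun G (finRotate (m + 1)))]
  refine Finset.sum_congr rfl fun a _ => ?_
  have h1 := List.prod_ofFn_comp_finRotate_eq_one_iff a
  have h2 := tensorMatrix_submatrix (finRotate (m + 1)) (fun k => R (e (a k) h))
  by_cases ha : (List.ofFn a).prod = 1
  · rw [if_pos ha, if_pos (by exact h1.2 ha)]
    exact congrFun (congrFun h2 f) g
  · rw [if_neg ha, if_neg (by exact fun h3 => ha (h1.1 h3))]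
    rfl

/-- The higher indicators of `D(G)` are algebraic integers. -/
theorem isIntegral_hopfIndicator {V : Type*} [AddCommGroup V] [Module ℂ V]
    [FiniteDimensional ℂ V] {Λ : DrinfeldDouble G} (hΛ : IsNormalizedIntegral Λ) {n : ℕ}
    (hn : 0 < n) (ρ : DrinfeldDouble G →ₐ[ℂ] Module.End ℂ V) :
    IsIntegral ℤ (hopfIndicator Λ n ρ) := by
  obtain ⟨m, rfl⟩ := Nat.exists_eq_succ_of_ne_zero hn.ne'
  let b := Module.finBasis ℂ V
  let R : DrinfeldDouble G →ₐ[ℂ] Matrix (Fin (Module.finrank ℂ V)) (Fin (Module.finrank ℂ V)) ℂ :=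
    (LinearMap.toMatrixAlgEquiv b).toAlgHom.comp ρ
  -- It remains to identify this trace with the indicator: term by term, the shift turns the tensor
  -- product of the operators into their composition.
  have h1 := Matrix.isIntegral_trace_submatrix_perm (integralMatrix_mul_self R (m + 1))
    (permFun _ (finRotate (m + 1))) (integralMatrix_submatrix R m)
  convert h1 using 1
  rw [hopfIndicator, LinearMap.trace_eq_matrix_trace ℂ b]
  change (R (sweedlerPower (m + 1) Λ)).trace = _
  rw [eq_of_isNormalizedIntegral hΛ, sweedlerPower_integral]
  have h2 : ∀ A : Matrix (Fin (m + 1) → Fin (Module.finrank ℂ V)) _ ℂ,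
      (A.submatrix id (permFun _ (finRotate (m + 1)))).trace =
        ∑ f, A f (permFun _ (finRotate (m + 1)) f) := fun A => rfl
  have h3 := fun A => (h2 (tensorMatrix A)).symm.trans (trace_tensorMatrix_submatrix_finRotate A)
  rw [h2]
  simp only [integralMatrix, Matrix.smul_apply, Matrix.sum_apply, map_smul, map_sum,
    Matrix.trace_smul, Matrix.trace_sum, ← Finset.smul_sum]
  congr 1
  rw [Finset.sum_comm]
  refine Finset.sum_congr rfl fun h _ => ?_
  rw [Finset.sum_comm, sweedlerPower_e_eq_sum_list_prod, map_sum, Matrix.trace_sum]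
  refine Finset.sum_congr rfl fun a _ => ?_
  split_ifs
  · rw [h3, map_list_prod, List.map_ofFn]
    rfl
  · simp

end DrinfeldDouble

/-! ### Traces on the induced modules and the indicator formula. -/

/-- The trace of an endomorphism of the coinvariants that lifts to `f`. -/
theorem Representation.trace_coinvariants {K U : Type*} [Group K] [Fintype K] [AddCommGroup U]
    [Module ℂ U] [FiniteDimensional ℂ U] (ρ : Representation ℂ K U) (f : Module.End ℂ U)
    (F : Module.End ℂ ρ.Coinvariants)
    (h : F ∘ₗ Representation.Coinvariants.mk ρ = Representation.Coinvariants.mk ρ ∘ₗ f) :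
    LinearMap.trace ℂ _ F =
      (Nat.card K : ℂ)⁻¹ * ∑ c : K, LinearMap.trace ℂ U (f ∘ₗ ρ c) := by
  have hcard : (Nat.card K : ℂ) ≠ 0 := by exact_mod_cast Nat.card_pos.ne'
  let A : Module.End ℂ U := (Nat.card K : ℂ)⁻¹ • ∑ c : K, ρ c
  have hA : ∀ x, A ∘ₗ ρ x = A := by
    intro x
    simp only [A, LinearMap.smul_comp]
    congr 1
    change (∑ c : K, ρ c) * ρ x = _
    rw [Finset.sum_mul]
    exact Fintype.sum_equiv (Equiv.mulRight x) _ _ fun c => by simp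
  -- Averaging over K descends to a section of the quotient map; cyclicity of the trace then moves
  -- the computation from the coinvariants to U.
  let s : ρ.Coinvariants →ₗ[ℂ] U := Representation.Coinvariants.lift ρ A hA
  have hs : Representation.Coinvariants.mk ρ ∘ₗ s = LinearMap.id := by
    refine Representation.Coinvariants.hom_ext (LinearMap.ext fun x => ?_)
    change Representation.Coinvariants.mk ρ (A x) = Representation.Coinvariants.mk ρ x
    simp only [A, LinearMap.smul_apply, LinearMap.sum_apply, map_smul, map_sum,
      Representation.Coinvariants.mk_self_apply, Finset.sum_const, Finset.card_univ]
    rw [← Nat.cast_smul_eq_nsmul ℂ, smul_smul, ← Nat.card_eq_fintype_card,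
      inv_mul_cancel₀ hcard, one_smul]
  have hF : F = Representation.Coinvariants.mk ρ ∘ₗ (f ∘ₗ s) := by
    rw [← LinearMap.comp_assoc, ← h, LinearMap.comp_assoc, hs, LinearMap.comp_id]
  have hfs : (f ∘ₗ s) ∘ₗ Representation.Coinvariants.mk ρ =
      (Nat.card K : ℂ)⁻¹ • ∑ c : K, f ∘ₗ ρ c := by
    rw [LinearMap.comp_assoc]
    change f ∘ₗ A = _
    rw [LinearMap.comp_smul]
    congr 1
    exact Finset.mul_sum _ _ _
  rw [hF, LinearMap.trace_comp_comm', hfs, map_smul, map_sum, smul_eq_mul]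

section

open scoped MonoidAlgebra

variable {G : Type*} [Group G] [Fintype G] [DecidableEq G]

/-- The operator sends each group element to a group element or to zero, so the trace counts fixed
basis vectors. -/
theorem trace_degreeFilter_comp (u a c k : G) :
    LinearMap.trace ℂ ℂ[G] ((degreeFilter u a ∘ₗ
      MonoidAlgebra.mapDomainLinearMap ℂ ℂ fun x => x * k⁻¹) ∘ₗ
        Representation.leftRegular ℂ G c) =
      ∑ x : G, if c * x * k⁻¹ = x ∧ x⁻¹ * u * x = a then 1 else 0 := by
  rw [LinearMap.trace_eq_matrix_trace ℂ (MonoidAlgebra.basis G ℂ), Matrix.trace]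
  refine Finset.sum_congr rfl fun x _ => ?_
  rw [Matrix.diag_apply, LinearMap.toMatrix_apply]
  have h1 := degreeFilter_single u a (c * x * k⁻¹)
  have h2 : ((degreeFilter u a ∘ₗ MonoidAlgebra.mapDomainLinearMap ℂ ℂ fun x => x * k⁻¹) ∘ₗ
        Representation.leftRegular ℂ G c) (MonoidAlgebra.basis G ℂ x) =
      if (c * x * k⁻¹)⁻¹ * u * (c * x * k⁻¹) = a then MonoidAlgebra.single (c * x * k⁻¹) 1
        else 0 := by
    rw [← h1]
    simp
  rw [h2]
  by_cases hx : c * x * k⁻¹ = x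
  · simp only [hx, true_and]
    split_ifs <;> simp [MonoidAlgebra.basis]
  · simp only [hx, false_and, if_false]
    split_ifs
    · simp [MonoidAlgebra.basis, hx]
    · simp

variable (u : G) {W : Type*} [AddCommGroup W] [Module ℂ W] [FiniteDimensional ℂ W]
  (η : Representation ℂ (centralizerOf u) W)

/-- The action lifts to ℂ[G] ⊗ W, acting on the first factor only, so each trace in the average over
C(u) is a product of traces. -/
theorem trace_doubleRep_e [Fintype (centralizerOf u)] (a k : G) :
    LinearMap.trace ℂ _ (doubleRep u η (DrinfeldDouble.e a k)) =
      (Nat.card (centralizerOf u) : ℂ)⁻¹ * ∑ c : centralizerOf u,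
        (∑ x : G, if (c : G) * x * k⁻¹ = x ∧ x⁻¹ * u * x = a then 1 else 0) * η.character c := by
  rw [Representation.trace_coinvariants
    (Representation.tprod ((Representation.leftRegular ℂ G).comp (centralizerOf u).subtype) η)
    ((degreeFilter u a ∘ₗ MonoidAlgebra.mapDomainLinearMap ℂ ℂ fun x => x * k⁻¹).rTensor W)]
  · congr 1
    refine Finset.sum_congr rfl fun c _ => ?_
    rw [← trace_degreeFilter_comp]
    refine Eq.trans ?_ (LinearMap.trace_tensorProduct' ((degreeFilter u a ∘ₗ
      MonoidAlgebra.mapDomainLinearMap ℂ ℂ fun x => x * k⁻¹) ∘ₗ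
        Representation.leftRegular ℂ G c) (η c))
    rw [Representation.tprod_apply, LinearMap.rTensor_comp_map]
    rfl
  · change (DrinfeldDouble.lin _ (DrinfeldDouble.e a k)) ∘ₗ _ = _
    rw [DrinfeldDouble.lin_e, LinearMap.rTensor_comp]
    rfl

/-- The element a is forced to be x⁻¹ux, and the substitution h ↦ x h x⁻¹ turns the remaining
conditions into membership in the root set. The sum is therefore independent of x. -/
theorem sum_ite_eq_ncard_rootSet (n : ℕ) (c x : G) :
    (∑ h : G, ∑ a : G, if (a * h⁻¹) ^ n * h ^ n = 1 then
      (if c * x * (h ^ n)⁻¹ = x ∧ x⁻¹ * u * x = a then (1 : ℂ) else 0) else 0) =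
      ((rootSet n u c).ncard : ℂ) := by
  classical
  have h1 : ∀ h : G, (∑ a : G, if (a * h⁻¹) ^ n * h ^ n = 1 then
      (if c * x * (h ^ n)⁻¹ = x ∧ x⁻¹ * u * x = a then (1 : ℂ) else 0) else 0) =
      if MulAut.conj x h ∈ rootSet n u c then 1 else 0 := by
    intro h
    rw [Finset.sum_eq_single (x⁻¹ * u * x)]
    · rw [← ite_and]
      congr 1
      have e1 : (x⁻¹ * u * x * h⁻¹) ^ n * h ^ n = 1 ↔
          (MulAut.conj x h * u⁻¹) ^ n = (MulAut.conj x h) ^ n := by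
        have e2 : MulAut.conj x h * u⁻¹ = x * (x⁻¹ * u * x * h⁻¹)⁻¹ * x⁻¹ := by
          rw [MulAut.conj_apply]; group
        rw [e2, conj_pow, MulAut.conj_apply, conj_pow, mul_left_inj, mul_right_inj, inv_pow,
          inv_eq_iff_mul_eq_one]
      have e3 : c * x * (h ^ n)⁻¹ = x ↔ (MulAut.conj x h) ^ n = c := by
        rw [MulAut.conj_apply, conj_pow, mul_inv_eq_iff_eq_mul, mul_inv_eq_iff_eq_mul, eq_comm]
      rw [e1, e3, rootSet, Set.mem_ofPred_eq]
      simp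
    · intro a _ ha
      have hne : ¬ (c * x * (h ^ n)⁻¹ = x ∧ x⁻¹ * u * x = a) := fun h => ha h.2.symm
      rw [if_neg hne, ite_self]
    · simp
  simp only [h1]
  refine (Equiv.sum_comp (MulAut.conj x).toEquiv
    (fun h => if h ∈ rootSet n u c then (1 : ℂ) else 0)).trans ?_
  rw [Finset.sum_boole, Set.ncard_eq_toFinset_card']
  congr 2
  ext y
  simp

/-- The indicators of the induced modules in terms of the functions `ζ_n`. -/
theorem hopfIndicator_doubleRep [Fintype (centralizerOf u)] {Λ : DrinfeldDouble G}
    (hΛ : IsNormalizedIntegral Λ) (n : ℕ) :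
    hopfIndicator Λ n (doubleRep u η) = (Nat.card (centralizerOf u) : ℂ)⁻¹ *
      ∑ c : centralizerOf u, zetaFun n u c * η.character c := by
  have hcard : (Fintype.card G : ℂ) ≠ 0 := by simp
  have h1 : ∀ h a : G, LinearMap.trace ℂ _ (doubleRep u η
      (if (a * h⁻¹) ^ n * h ^ n = 1 then DrinfeldDouble.e a (h ^ n) else 0)) =
      (Nat.card (centralizerOf u) : ℂ)⁻¹ * ∑ c : centralizerOf u, ∑ x : G,
        (if (a * h⁻¹) ^ n * h ^ n = 1 then
          (if (c : G) * x * (h ^ n)⁻¹ = x ∧ x⁻¹ * u * x = a then (1 : ℂ) else 0) else 0) *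
            η.character c := by
    intro h a
    split_ifs
    · rw [trace_doubleRep_e]
      simp only [Finset.sum_mul]
    · simp
  rw [hopfIndicator, DrinfeldDouble.eq_of_isNormalizedIntegral hΛ,
    DrinfeldDouble.sweedlerPower_integral, map_smul, map_smul, map_sum, map_sum]
  simp only [DrinfeldDouble.sweedlerPower_e, map_sum, h1, ← Finset.mul_sum]
  rw [smul_eq_mul, mul_left_comm]
  congr 1
  have h2 : (∑ h : G, ∑ a : G, ∑ c : centralizerOf u, ∑ x : G,
      (if (a * h⁻¹) ^ n * h ^ n = 1 then
          (if (c : G) * x * (h ^ n)⁻¹ = x ∧ x⁻¹ * u * x = a then (1 : ℂ) else 0) else 0) *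
            η.character c) =
      ∑ c : centralizerOf u, ∑ x : G, (∑ h : G, ∑ a : G, (if (a * h⁻¹) ^ n * h ^ n = 1 then
          (if (c : G) * x * (h ^ n)⁻¹ = x ∧ x⁻¹ * u * x = a then (1 : ℂ) else 0) else 0)) *
            η.character c := by
    simp only [Finset.sum_mul]
    rw [Finset.sum_congr rfl fun h _ => Finset.sum_comm, Finset.sum_comm]
    refine Finset.sum_congr rfl fun c _ => ?_
    rw [Finset.sum_congr rfl fun h _ => Finset.sum_comm, Finset.sum_comm]
  rw [h2]
  simp only [sum_ite_eq_ncard_rootSet, Finset.sum_const, Finset.card_univ, nsmul_eq_mul]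
  -- The sum over x contributes a factor |G|, which cancels the normalization of the integral.
  rw [← Finset.mul_sum, inv_mul_cancel_left₀ hcard]
  rfl

end

/-! ### Integral and rational multiplicities. -/

section

variable {G : Type*} [Group G] [Finite G]

theorem irrChars_subset_cyclotomicFunctions {ω : ℂ} (hω : IsPrimitiveRoot ω (Nat.card G)) :
    irrChars G ⊆ cyclotomicFunctions G ω := by
  rintro _ ⟨W, _, _, _, ρ, -, rfl⟩
  exact ρ.character_mem_cyclotomicFunctions hω

theorem virtualChars_le_cyclotomicFunctions {ω : ℂ} (hω : IsPrimitiveRoot ω (Nat.card G)) :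
    virtualChars G ≤ (cyclotomicFunctions G ω).toAddSubgroup := by
  rw [virtualChars, AddSubgroup.closure_le]
  exact irrChars_subset_cyclotomicFunctions hω

theorem mem_virtualChars_of_cfInner_int {f : G → ℂ} (hf : ∀ g h, f (h * g * h⁻¹) = f g)
    (h : ∀ χ ∈ irrChars G, ∃ m : ℤ, cfInner f χ = m) : f ∈ virtualChars G := by
  rw [eq_sum_cfInner_smul f hf]
  refine sum_mem fun χ hχ => ?_
  rw [Set.Finite.mem_toFinset] at hχ
  obtain ⟨m, hm⟩ := h χ hχ
  rw [hm, Int.cast_smul_eq_zsmul]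
  exact zsmul_mem (AddSubgroup.subset_closure hχ) m

theorem mem_cyclotomicFunctions_of_cfInner_rat {ω : ℂ} (hω : IsPrimitiveRoot ω (Nat.card G))
    {f : G → ℂ} (hf : ∀ g h, f (h * g * h⁻¹) = f g)
    (h : ∀ χ ∈ irrChars G, ∃ q : ℚ, cfInner f χ = q) : f ∈ cyclotomicFunctions G ω := by
  rw [eq_sum_cfInner_smul f hf]
  refine sum_mem fun χ hχ => ?_
  rw [Set.Finite.mem_toFinset] at hχ
  obtain ⟨q, hq⟩ := h χ hχ
  rw [hq, Rat.cast_smul_eq_qsmul]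
  exact Submodule.smul_mem _ q (irrChars_subset_cyclotomicFunctions hω hχ)

open Polynomial in
/-- A rational-valued function that is constant along powers prime to `|G|` has rational
multiplicities. -/
theorem exists_rat_card_inv_mul_sum_mul_character [Fintype G] {f : G → ℂ}
    (hq : ∀ g, ∃ q : ℚ, f g = q) (hf : ∀ g (m : ℕ), m.Coprime (Nat.card G) → f (g ^ m) = f g)
    {V : Type*} [AddCommGroup V] [Module ℂ V] [FiniteDimensional ℂ V]
    (ρ : Representation ℂ G V) :
    ∃ q : ℚ, (Nat.card G : ℂ)⁻¹ * ∑ g, f g * ρ.character g = q := by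
  have hω := Complex.isPrimitiveRoot_exp (Nat.card G) Nat.card_pos.ne'
  set ω := Complex.exp (2 * Real.pi * Complex.I / (Nat.card G : ℂ))
  choose q hq using hq
  choose p hp using ρ.character_mem_cyclotomicFunctions hω
  let P : ℚ[X] := C ((Nat.card G : ℚ)⁻¹) * ∑ g, C (q g) * p g
  have hP : ∀ m : ℕ, m.Coprime (Nat.card G) →
      aeval (ω ^ m) P = (Nat.card G : ℂ)⁻¹ * ∑ g, f g * ρ.character g := by
    intro m hm
    -- For m prime to |G| the map g ↦ g ^ m permutes G and preserves f, so replacing ω by ω ^ m does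
    -- not change the sum.
    rw [← Equiv.sum_comp (powCoprime hm.symm)]
    simp only [powCoprime_apply, hf _ m hm, hp, hq]
    simp [P]
  have h1 := hP 1 (Nat.coprime_one_left _)
  rw [pow_one] at h1
  rw [← h1]
  exact hω.exists_rat_of_aeval_pow_eq Nat.card_pos fun m hm => (hP m hm).trans h1.symm

/-- For a real-valued function, `cfInner f χ` is the conjugate of the bilinear pairing. -/
theorem cfInner_eq_conj [Fintype G] {f : G → ℂ} (hf : ∀ g, (starRingEnd ℂ) (f g) = f g)
    (χ : G → ℂ) :
    cfInner f χ = (starRingEnd ℂ) ((Nat.card G : ℂ)⁻¹ * ∑ g, f g * χ g) := by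
  rw [cfInner_eq_sum]
  simp [map_sum, hf]

end

/-- Units lift along ℤ/b → ℤ/a. This replaces an exponent prime to the order of a subgroup by one
prime to the order of the whole group. -/
theorem Nat.exists_modEq_coprime_of_dvd {a b m : ℕ} (hb : b ≠ 0) (hab : a ∣ b)
    (hm : m.Coprime a) : ∃ k : ℕ, k ≡ m [MOD a] ∧ k.Coprime b := by
  have : NeZero b := ⟨hb⟩
  obtain ⟨v, hv⟩ := ZMod.unitsMap_surjective hab (ZMod.unitOfCoprime m hm)
  refine ⟨(v : ZMod b).val, ?_, ZMod.val_coe_unit_coprime v⟩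
  rw [← ZMod.natCast_eq_natCast_iff]
  have h := congrArg (fun w : (ZMod a)ˣ => (w : ZMod a)) hv
  simpa [ZMod.unitsMap_def] using h

/-! ### Conjugation invariance of ζ_n and the equivalences. -/

section

variable {G : Type*} [Group G] (n : ℕ) (u : G)

/-- Conjugation by h fixes u, so it carries one root set bijectively onto the other. -/
theorem zetaFun_conj (g h : centralizerOf u) : zetaFun n u (h * g * h⁻¹) = zetaFun n u g := by
  have hu : (h : G) * u⁻¹ * (h : G)⁻¹ = u⁻¹ := by
    have h1 : (h : G) * u = u * h := Subgroup.mem_centralizer_singleton_iff.mp h.2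
    rw [mul_inv_eq_iff_eq_mul, eq_inv_mul_iff_mul_eq, ← mul_assoc, ← h1, mul_inv_cancel_right]
  have h2 : rootSet n u ((h * g * h⁻¹ : centralizerOf u) : G) =
      Set.image (MulAut.conj (h : G)) (rootSet n u g) := by
    ext a
    obtain ⟨b, rfl⟩ := (MulAut.conj (h : G)).surjective a
    rw [(MulAut.conj (h : G)).injective.mem_set_image]
    have h3 : MulAut.conj (h : G) b * u⁻¹ = MulAut.conj (h : G) (b * u⁻¹) := by
      rw [map_mul, MulAut.conj_apply _ u⁻¹, hu]
    have h4 : ((h * g * h⁻¹ : centralizerOf u) : G) = MulAut.conj (h : G) g := rfl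
    simp only [rootSet, Set.mem_ofPred_eq, h3, h4, ← map_pow, EmbeddingLike.apply_eq_iff_eq]
  rw [zetaFun, zetaFun, h2, Set.ncard_image_of_injective _ (MulAut.conj (h : G)).injective]

theorem zetaFun_eq_of_isConj {g h : centralizerOf u} (hgh : IsConj g h) :
    zetaFun n u h = zetaFun n u g := by
  obtain ⟨c, rfl⟩ := isConj_iff.1 hgh
  exact zetaFun_conj n u g c

end

theorem mainTheorem1 {G : Type*} [Group G] [Fintype G] [DecidableEq G]
    (u : G) (n : ℕ) (hn : 0 < n)
    (Λ : DrinfeldDouble G) (hΛ : IsNormalizedIntegral Λ) :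
    List.TFAE [
      ∀ (W : Type) [AddCommGroup W] [Module ℂ W] [FiniteDimensional ℂ W]
        (η : Representation ℂ (centralizerOf u) W), η.IsIrreducible →
          ∃ m : ℤ, hopfIndicator Λ n (doubleRep u η) = (m : ℂ),
      zetaFun n u ∈ virtualChars (centralizerOf u),
      ∀ H : Subgroup (centralizerOf u), IsCyclic H → ∀ χ ∈ irrChars H,
        ∃ q : ℚ, cfInner (fun h : H => zetaFun n u (h : centralizerOf u)) χ = (q : ℂ),
      ∀ g h : centralizerOf u, RationallyConj g h → zetaFun n u g = zetaFun n u h] := by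
  have := Fintype.ofFinite (centralizerOf u)
  have hrat : ∀ g, ∃ q : ℚ, zetaFun n u g = q := fun g => ⟨((rootSet n u (g : G)).ncard : ℚ), by
    simp [zetaFun]⟩
  have hreal : ∀ g, (starRingEnd ℂ) (zetaFun n u g) = zetaFun n u g := fun g => by
    simp [zetaFun]
  tfae_have 1 → 2 := by
    intro h
    refine mem_virtualChars_of_cfInner_int (fun g c => zetaFun_conj n u g c) ?_
    rintro _ ⟨W, _, _, _, η, hη, rfl⟩
    obtain ⟨m, hm⟩ := h W η hη
    refine ⟨m, ?_⟩
    -- The multiplicity of η in ζ_n is the conjugate of the indicator of χ_η.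
    rw [cfInner_eq_conj hreal, ← hopfIndicator_doubleRep u η hΛ, hm, map_intCast]
  tfae_have 2 → 4 := by
    rintro hmem g h ⟨m, hm, hconj⟩
    have hω := Complex.isPrimitiveRoot_exp (Nat.card (centralizerOf u)) Nat.card_pos.ne'
    obtain ⟨q, hq⟩ := hrat g
    rw [zetaFun_eq_of_isConj n u hconj, apply_pow_eq_of_mem_cyclotomicFunctions hω
      (virtualChars_le_cyclotomicFunctions hω hmem) hq hm]
  tfae_have 4 → 1 := by
    intro h W _ _ _ η _
    obtain ⟨q, hq⟩ := exists_rat_card_inv_mul_sum_mul_character hrat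
      (fun g m hm => (h g (g ^ m) ⟨m, hm, IsConj.refl _⟩).symm) η
    -- The indicator is rational and an algebraic integer, hence an integer.
    have hint := DrinfeldDouble.isIntegral_hopfIndicator hΛ hn (doubleRep u η)
    rw [hopfIndicator_doubleRep u η hΛ, hq] at hint
    have hint' : IsIntegral ℤ q :=
      (isIntegral_algebraMap_iff (algebraMap ℚ ℂ).injective).1 (by simpa using hint)
    obtain ⟨m, hm⟩ := IsIntegrallyClosed.isIntegral_iff.1 hint'
    refine ⟨m, ?_⟩
    rw [hopfIndicator_doubleRep u η hΛ, hq, ← hm]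
    simp
  tfae_have 3 → 4 := by
    rintro h g k ⟨m, hm, hconj⟩
    have hω := Complex.isPrimitiveRoot_exp (Nat.card (Subgroup.zpowers g)) Nat.card_pos.ne'
    -- The cyclic group generated by g contains all powers of g, so condition 3 is needed there
    -- only; exponents prime to |C| remain prime to its order.
    have hmem := mem_cyclotomicFunctions_of_cfInner_rat hω
      (f := fun x : Subgroup.zpowers g => zetaFun n u (x : centralizerOf u))
      (fun x y => zetaFun_conj n u x y) (h (Subgroup.zpowers g) inferInstance)
    obtain ⟨q, hq⟩ := hrat g
    have h1 := apply_pow_eq_of_mem_cyclotomicFunctions hω hmem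
      (g := ⟨g, Subgroup.mem_zpowers g⟩) hq
      (hm.coprime_dvd_right (Subgroup.card_subgroup_dvd_card _))
    rw [zetaFun_eq_of_isConj n u hconj]
    exact h1.symm
  tfae_have 4 → 3 := by
    rintro h H - _ ⟨W, _, _, _, ρ, -, rfl⟩
    have := Fintype.ofFinite H
    obtain ⟨q, hq⟩ := exists_rat_card_inv_mul_sum_mul_character
      (f := fun x : H => zetaFun n u (x : centralizerOf u)) (fun x => hrat x)
      (fun x m hm => by
        -- Condition 4 concerns exponents prime to |C|, while m is only prime to |H|; the exponent k
        -- defines the same power of x.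
        obtain ⟨k, hkm, hk⟩ := Nat.exists_modEq_coprime_of_dvd
          (Nat.card_pos (α := centralizerOf u)).ne' (Subgroup.card_subgroup_dvd_card H) hm
        have h1 : x ^ m = x ^ k :=
          pow_eq_pow_iff_modEq.2 ((hkm.of_dvd (orderOf_dvd_natCard x)).symm)
        rw [h1]
        exact (h _ _ ⟨k, hk, IsConj.refl _⟩).symm) ρ
    refine ⟨q, ?_⟩
    rw [cfInner_eq_conj (f := fun x : H => zetaFun n u (x : centralizerOf u)) fun x => hreal x, hq]
    simp
  tfae_finish
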